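/- **Setting.** $\mathsf{L}_2$ is the two-sorted language of second-order arithmetic with signature $\langle 0,1,+,\times,<,=_{\mathbb N},\in\rangle$. A structure consists of a set of numbers with interpretations of $0,1,+,\times,<$ and a nonempty collection of subsets of it, over which set quantifiers range. A theory proves a sentence if the sentence holds in all models of the theory (by the completeness theorem this is formal provability). $\mathsf{RCA}_0$ consists of the axioms of discretely ordered semirings, $\Sigma^0_1$ induction and $\Delta^0_1$ comprehension; $\Gamma\text{-}\mathsf{CA}_0$ is $\mathsf{RCA}_0$ together with comprehension for formulas in $\Gamma$; $\mathsf{ACA}_0$ is $\mathsf{RCA}_0$ together with comprehension for all formulas without set quantifiers; $\mathsf{Z}_2$ consists of the axioms of discretely ordered semirings with full comprehension and full induction. Formulas in all schemes may have number and set parameters, unless stated otherwise. $\Delta^i_n$ comprehension says: if $\varphi\in\Sigma^i_n$, $\psi\in\Pi^i_n$ and $(\forall x)[\varphi(x)\leftrightarrow\psi(x)]$, then $\{x:\varphi(x)\}$ exists. **Classes.** $\Sigma^0_0=\Pi^0_0$ is the class of bounded-quantifier formulas; $\Sigma^0_n$ and $\Pi^0_n$ are the usual prenex classes of $n$ alternating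 blocks of number quantifiers over a bounded-quantifier matrix. *Strict* $\Sigma^1_n$ and $\Pi^1_n$ formulas are prenex: $n$ alternating blocks of set quantifiers over a matrix without set quantifiers. The classes $\Sigma^1_n$ and $\Pi^1_n$ themselves are closed under number quantification: a $\Sigma^1_n$ (resp. $\Pi^1_n$) formula is a strict one preceded by any prefix of number quantifiers. $\Delta^1_n$ and strict $\Delta^1_n$ refer to pairs of equivalent formulas from the corresponding classes. **Finite character.** A formula $\varphi(X)$ is of finite character if $\varphi(\emptyset)$ holds and, for every set $A$, $\varphi(A)$ holds if and only if $\varphi(F)$ holds for every finite $F\subseteq A$. $\mathsf{FCP}$ is the scheme: for each formula $\varphi(X)$, if $\varphi$ is of finite character, then every set $A$ has a $\subseteq$-maximal subset $B$ such that $\varphi(B)$ holds. $\Gamma\text{-}\mathsf{FCP}$ is its restriction to $\varphi\in\Gamma$; $\Delta^i_n\text{-}\mathsf{FCP}$ is its restriction to $\varphi\in\Sigma^i_n$ for which there is $\psi\in\Pi^i_n$ with $(\forall X)[\varphi(X)\leftrightarrow\psi(X)]$; $\mathsf{QF}\text{-}\mathsf{FCP}$ is its restriction to quantifier-free formulas without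 parameters. **Theorem.** Let $n\ge 1$. 1. For $i\in\{0,1\}$ and $\Gamma$ any of $\Pi^i_n,\Sigma^i_n,\Delta^i_n$, and also for $\Gamma$ any of strict $\Pi^1_n$, strict $\Sigma^1_n$, strict $\Delta^1_n$, the theory $\Gamma\text{-}\mathsf{CA}_0$ proves $\Gamma\text{-}\mathsf{FCP}$. 2. If $\Gamma$ is $\Pi^0_n$, $\Pi^1_n$, strict $\Pi^1_n$, $\Sigma^1_n$ or $\Delta^1_n$, then $\Gamma\text{-}\mathsf{FCP}$ implies $\Gamma\text{-}\mathsf{CA}_0$ over $\mathsf{RCA}_0$. **Corollary.** The following are provable in $\mathsf{RCA}_0$. 1. $\Delta^0_1\text{-}\mathsf{FCP}$, $\Sigma^0_0\text{-}\mathsf{FCP}$ and $\mathsf{QF}\text{-}\mathsf{FCP}$. 2. For each $n\ge1$, $\mathsf{ACA}_0$ is equivalent to $\Pi^0_n\text{-}\mathsf{FCP}$. 3. For each $n\ge1$, $\Delta^1_n\text{-}\mathsf{CA}_0$ is equivalent to $\Delta^1_n\text{-}\mathsf{FCP}$. 4. For each $n\ge1$, $\Pi^1_n\text{-}\mathsf{CA}_0$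 and strict $\Pi^1_n\text{-}\mathsf{CA}_0$ are both equivalent to each of $\Pi^1_n\text{-}\mathsf{FCP}$, strict $\Pi^1_n\text{-}\mathsf{FCP}$ and $\Sigma^1_n\text{-}\mathsf{FCP}$. 5. $\mathsf{Z}_2$ is equivalent to $\mathsf{FCP}$. -/

import Mathlib

universe u

namespace SOA

/-! ### The two-sorted language of second-order arithmetic -/

/-- Number terms over `0, 1, +, ×` with free number variables `0, …, n - 1`. -/
inductive Tm (n : ℕ) : Type
  | var (i : Fin n) : Tm n
  | zero : Tm n
  | one : Tm n
  | add (s t : Tm n) : Tm n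
  | mul (s t : Tm n) : Tm n

/-- Formulas with `k` free set variables and `n` free number variables (de Bruijn indices: a
quantifier binds the variable of index `0` of its scope). Equality is equality of numbers. -/
inductive Fm : ℕ → ℕ → Type
  | eq {k n : ℕ} (s t : Tm n) : Fm k n
  | lt {k n : ℕ} (s t : Tm n) : Fm k n
  | mem {k n : ℕ} (t : Tm n) (X : Fin k) : Fm k n
  | neg {k n : ℕ} (φ : Fm k n) : Fm k n
  | and {k n : ℕ} (φ ψ : Fm k n) : Fm k n
  | or {k n : ℕ} (φ ψ : Fm k n) : Fm k n
  | allN {k n : ℕ} (φ : Fm k (n + 1)) : Fm k n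
  | exN {k n : ℕ} (φ : Fm k (n + 1)) : Fm k n
  | allS {k n : ℕ} (φ : Fm (k + 1) n) : Fm k n
  | exS {k n : ℕ} (φ : Fm (k + 1) n) : Fm k n

/-- Substitution of terms for number variables in a term. -/
def Tm.subst {n m : ℕ} (σ : Fin n → Tm m) : Tm n → Tm m
  | .var i => σ i
  | .zero => .zero
  | .one => .one
  | .add s t => .add (s.subst σ) (t.subst σ)
  | .mul s t => .mul (s.subst σ) (t.subst σ)

/-- Weakening of a term by a new variable of index `0`. -/
def Tm.lift {n : ℕ} (t : Tm n) : Tm (n + 1) := t.subst fun i => .var i.succ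

/-- Capture-avoiding substitution of set variables for set variables and of number terms for
number variables. -/
def Fm.subst : {k n : ℕ} → Fm k n → {k' n' : ℕ} → (Fin k → Fin k') → (Fin n → Tm n') → Fm k' n'
  | _, _, .eq s t, _, _, _, σ => .eq (s.subst σ) (t.subst σ)
  | _, _, .lt s t, _, _, _, σ => .lt (s.subst σ) (t.subst σ)
  | _, _, .mem t X, _, _, f, σ => .mem (t.subst σ) (f X)
  | _, _, .neg φ, _, _, f, σ => .neg (φ.subst f σ)
  | _, _, .and φ ψ, _, _, f, σ => .and (φ.subst f σ) (ψ.subst f σ)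
  | _, _, .or φ ψ, _, _, f, σ => .or (φ.subst f σ) (ψ.subst f σ)
  | _, _, .allN φ, _, _, f, σ => .allN (φ.subst f (Fin.cons (.var 0) fun i => (σ i).lift))
  | _, _, .exN φ, _, _, f, σ => .exN (φ.subst f (Fin.cons (.var 0) fun i => (σ i).lift))
  | _, _, .allS φ, _, _, f, σ => .allS (φ.subst (Fin.cons 0 fun i => (f i).succ) σ)
  | _, _, .exS φ, _, _, f, σ => .exS (φ.subst (Fin.cons 0 fun i => (f i).succ) σ)

/-- Implication. -/
def Fm.imp {k n : ℕ} (φ ψ : Fm k n) : Fm k n := .or (.neg φ) ψ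

/-- Equivalence. -/
def Fm.iff {k n : ℕ} (φ ψ : Fm k n) : Fm k n := .and (φ.imp ψ) (ψ.imp φ)

/-- Universal closure with respect to the number variables. -/
def Fm.closeN {k : ℕ} : {n : ℕ} → Fm k n → Fm k 0
  | 0, φ => φ
  | _ + 1, φ => Fm.closeN (.allN φ)

/-- Universal closure with respect to the set variables. -/
def Fm.closeS : {k : ℕ} → Fm k 0 → Fm 0 0
  | 0, φ => φ
  | _ + 1, φ => Fm.closeS (.allS φ)

/-- Universal closure: this is how parameters are treated. -/
def Fm.close {k n : ℕ} (φ : Fm k n) : Fm 0 0 := φ.closeN.closeS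

/-! ### Structures, theories and provability -/

/-- General (Henkin) structures: the set quantifiers range over the collection `sets`. -/
structure Str : Type (u + 1) where
  N : Type u
  zero : N
  one : N
  add : N → N → N
  mul : N → N → N
  lt : N → N → Prop
  sets : Set (Set N)
  sets_nonempty : sets.Nonempty

/-- The value of a term. -/
def Tm.val (M : Str.{u}) {n : ℕ} (v : Fin n → M.N) : Tm n → M.N
  | .var i => v i
  | .zero => M.zero
  | .one => M.one
  | .add s t => M.add (s.val M v) (t.val M v)
  | .mul s t => M.mul (s.val M v) (t.val M v)

/-- Satisfaction of a formula under an assignment of sets and numbers to its variables. -/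
def Fm.Sat (M : Str.{u}) : {k n : ℕ} → Fm k n → (Fin k → M.sets) → (Fin n → M.N) → Prop
  | _, _, .eq s t, _, v => s.val M v = t.val M v
  | _, _, .lt s t, _, v => M.lt (s.val M v) (t.val M v)
  | _, _, .mem t X, V, v => t.val M v ∈ (V X).1
  | _, _, .neg φ, V, v => ¬ φ.Sat M V v
  | _, _, .and φ ψ, V, v => φ.Sat M V v ∧ ψ.Sat M V v
  | _, _, .or φ ψ, V, v => φ.Sat M V v ∨ ψ.Sat M V v
  | _, _, .allN φ, V, v => ∀ a : M.N, φ.Sat M V (Fin.cons a v)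
  | _, _, .exN φ, V, v => ∃ a : M.N, φ.Sat M V (Fin.cons a v)
  | _, _, .allS φ, V, v => ∀ A : M.sets, φ.Sat M (Fin.cons A V) v
  | _, _, .exS φ, V, v => ∃ A : M.sets, φ.Sat M (Fin.cons A V) v

/-- A theory is a set of sentences. -/
abbrev Theory := Set (Fm 0 0)

/-- `M` is a model of `T`. -/
def Str.Models (M : Str.{u}) (T : Theory) : Prop :=
  ∀ φ ∈ T, φ.Sat M Fin.elim0 Fin.elim0

/-- `T` proves every sentence of `U`: every model of `T` is a model of `U`. -/
def Proves (T U : Theory) : Prop := ∀ M : Str.{u}, M.Models T → M.Models U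

/-- `B` proves that `T` and `U` are equivalent. -/
def EquivOver (B T U : Theory) : Prop := Proves.{u} (B ∪ T) U ∧ Proves.{u} (B ∪ U) T

/-! ### Classes of formulas -/

/-- A class of formulas (with any numbers of free variables). -/
abbrev FmClass := ∀ {k n : ℕ}, Fm k n → Prop

/-- Quantifier-free formulas. -/
def IsQF : {k n : ℕ} → Fm k n → Prop
  | _, _, .eq _ _ => True
  | _, _, .lt _ _ => True
  | _, _, .mem _ _ => True
  | _, _, .neg φ => IsQF φ
  | _, _, .and φ ψ => IsQF φ ∧ IsQF ψ
  | _, _, .or φ ψ => IsQF φ ∧ IsQF ψ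
  | _, _, .allN _ => False
  | _, _, .exN _ => False
  | _, _, .allS _ => False
  | _, _, .exS _ => False

/-- Arithmetical formulas: no set quantifiers, but possibly free set variables. -/
def IsArith : {k n : ℕ} → Fm k n → Prop
  | _, _, .eq _ _ => True
  | _, _, .lt _ _ => True
  | _, _, .mem _ _ => True
  | _, _, .neg φ => IsArith φ
  | _, _, .and φ ψ => IsArith φ ∧ IsArith ψ
  | _, _, .or φ ψ => IsArith φ ∧ IsArith ψ
  | _, _, .allN φ => IsArith φ
  | _, _, .exN φ => IsArith φ
  | _, _, .allS _ => False
  | _, _, .exS _ => False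

/-- Bounded-quantifier formulas: all quantifiers are of the form `∀ x < t` or `∃ x < t`, where
the variable `x` does not occur in the term `t`. -/
inductive IsBdd : ∀ {k n : ℕ}, Fm k n → Prop
  | eq {k n : ℕ} (s t : Tm n) : IsBdd (.eq s t : Fm k n)
  | lt {k n : ℕ} (s t : Tm n) : IsBdd (.lt s t : Fm k n)
  | mem {k n : ℕ} (t : Tm n) (X : Fin k) : IsBdd (.mem t X)
  | neg {k n : ℕ} {φ : Fm k n} : IsBdd φ → IsBdd (.neg φ)
  | and {k n : ℕ} {φ ψ : Fm k n} : IsBdd φ → IsBdd ψ → IsBdd (.and φ ψ)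
  | or {k n : ℕ} {φ ψ : Fm k n} : IsBdd φ → IsBdd ψ → IsBdd (.or φ ψ)
  | ball {k n : ℕ} (t : Tm n) {φ : Fm k (n + 1)} :
      IsBdd φ → IsBdd (.allN (.imp (.lt (.var 0) t.lift) φ))
  | bex {k n : ℕ} (t : Tm n) {φ : Fm k (n + 1)} :
      IsBdd φ → IsBdd (.exN (.and (.lt (.var 0) t.lift) φ))

/-- The two sides `Σ` and `Π` of a hierarchy. -/
inductive Side
  | sigma
  | pi

/-- The other side. -/
def Side.dual : Side → Side
  | .sigma => .pi
  | .pi => .sigma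

/-- The arithmetical hierarchy: `Hier0 .sigma m` is `Σ⁰ₘ` and `Hier0 .pi m` is `Π⁰ₘ`. Prenex
formulas with `m` alternating blocks of number quantifiers and a bounded-quantifier matrix. -/
inductive Hier0 : Side → ℕ → ∀ {k n : ℕ}, Fm k n → Prop
  | base {s : Side} {k n : ℕ} {φ : Fm k n} : IsBdd φ → Hier0 s 0 φ
  | up {s : Side} {m k n : ℕ} {φ : Fm k n} : Hier0 s.dual m φ → Hier0 s (m + 1) φ
  | ex {m k n : ℕ} {φ : Fm k (n + 1)} : Hier0 .sigma (m + 1) φ → Hier0 .sigma (m + 1) (.exN φ)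
  | all {m k n : ℕ} {φ : Fm k (n + 1)} : Hier0 .pi (m + 1) φ → Hier0 .pi (m + 1) (.allN φ)

/-- The analytical hierarchy in strict prenex form: `m` alternating blocks of set quantifiers and
an arithmetical matrix. -/
inductive Hier1Strict : Side → ℕ → ∀ {k n : ℕ}, Fm k n → Prop
  | base {s : Side} {k n : ℕ} {φ : Fm k n} : IsArith φ → Hier1Strict s 0 φ
  | up {s : Side} {m k n : ℕ} {φ : Fm k n} : Hier1Strict s.dual m φ → Hier1Strict s (m + 1) φ
  | ex {m k n : ℕ} {φ : Fm (k + 1) n} :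
      Hier1Strict .sigma (m + 1) φ → Hier1Strict .sigma (m + 1) (.exS φ)
  | all {m k n : ℕ} {φ : Fm (k + 1) n} :
      Hier1Strict .pi (m + 1) φ → Hier1Strict .pi (m + 1) (.allS φ)

/-- The analytical hierarchy with each class closed under number quantification: a prefix of
number quantifiers, followed by a formula in strict prenex form. -/
inductive Hier1Closed : Side → ℕ → ∀ {k n : ℕ}, Fm k n → Prop
  | strict {s : Side} {m k n : ℕ} {φ : Fm k n} : Hier1Strict s m φ → Hier1Closed s m φ
  | ex {s : Side} {m k n : ℕ} {φ : Fm k (n + 1)} :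
      Hier1Closed s m φ → Hier1Closed s m (.exN φ)
  | all {s : Side} {m k n : ℕ} {φ : Fm k (n + 1)} :
      Hier1Closed s m φ → Hier1Closed s m (.allN φ)

/-- The two customary readings of `Σ¹ₘ` and `Π¹ₘ`: strict prenex form, or closed under number
quantification. -/
inductive Reading
  | strict
  | closed

/-- `Σ¹ₘ` and `Π¹ₘ` in the given reading. -/
def Hier1 : Reading → Side → ℕ → ∀ {k n : ℕ}, Fm k n → Prop
  | .strict, s, m, _, _, φ => Hier1Strict s m φ
  | .closed, s, m, _, _, φ => Hier1Closed s m φ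

/-! ### Induction, comprehension, and the finite character principle -/

/-- `(φ(0) ∧ ∀ x (φ(x) → φ(x + 1))) → ∀ x φ(x)`. -/
def indFm {k n : ℕ} (φ : Fm k (n + 1)) : Fm k n :=
  .imp
    (.and (φ.subst id (Fin.cons .zero .var))
      (.allN (φ.imp (φ.subst id (Fin.cons (.add (.var 0) .one) fun i => .var i.succ)))))
    (.allN φ)

/-- `∃ X ∀ x (x ∈ X ↔ φ(x))`, where `X` does not occur in `φ`. -/
def caFm {k n : ℕ} (φ : Fm k (n + 1)) : Fm k n :=
  .exS (.allN (.iff (.mem (.var 0) 0) (φ.subst Fin.succ .var)))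

/-- `X ⊆ Y`. -/
def subFm {k n : ℕ} (X Y : Fin k) : Fm k n := .allN (.imp (.mem (.var 0) X) (.mem (.var 0) Y))

/-- `X = ∅`. -/
def emptyFm {k n : ℕ} (X : Fin k) : Fm k n := .allN (.neg (.mem (.var 0) X))

/-- `X` is finite, that is, `∃ b ∀ x (x ∈ X → x < b)`. -/
def finFm {k n : ℕ} (X : Fin k) : Fm k n :=
  .exN (.allN (.imp (.mem (.var 0) X) (.lt (.var 0) (.var 1))))

/-- `φ(X)` as a formula in a context with one more set variable, of index `1`. -/
def skip1 {k n : ℕ} (φ : Fm (k + 1) n) : Fm (k + 2) n :=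
  φ.subst (Fin.cons 0 fun i => i.succ.succ) .var

/-- `φ(X)` as a formula in a context with two more set variables, of indices `1` and `2`. -/
def skip2 {k n : ℕ} (φ : Fm (k + 1) n) : Fm (k + 3) n :=
  φ.subst (Fin.cons 0 fun i => i.succ.succ.succ) .var

/-- `φ(X)` is of finite character (`X` is the set variable of index `0`): `φ(∅)` holds, and for
every set `A`, `φ(A)` holds if and only if `φ(F)` holds for every finite `F ⊆ A`. -/
def finCharFm {k n : ℕ} (φ : Fm (k + 1) n) : Fm k n :=
  .and (.allS (.imp (emptyFm 0) φ))
    (.allS (.iff φ (.allS (.imp (.and (subFm 0 1) (finFm 0)) (skip1 φ)))))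

/-- Every set `A` has a subset `B` with `φ(B)` that is `⊆`-maximal among the subsets `C` of `A`
with `φ(C)`. -/
def maximalFm {k n : ℕ} (φ : Fm (k + 1) n) : Fm k n :=
  .allS (.exS (.and (.and (subFm 0 1) (skip1 φ))
    (.allS (.imp (.and (.and (subFm 1 0) (subFm 0 2)) (skip2 φ)) (subFm 0 1)))))

/-- The induction scheme for formulas in `C`. -/
def ind (C : FmClass) : Theory :=
  {σ | ∃ (k n : ℕ) (φ : Fm k (n + 1)), C φ ∧ σ = (indFm φ).close}

/-- The comprehension scheme for formulas in `C`. -/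
def ca (C : FmClass) : Theory :=
  {σ | ∃ (k n : ℕ) (φ : Fm k (n + 1)), C φ ∧ σ = (caFm φ).close}

/-- The comprehension scheme for formulas in `S` that are equivalent to a formula in `P`. -/
def caDelta (S P : FmClass) : Theory :=
  {σ | ∃ (k n : ℕ) (φ ψ : Fm k (n + 1)), S φ ∧ P ψ ∧
    σ = (Fm.imp (.allN (φ.iff ψ)) (caFm φ)).close}

/-- The finite character principle for formulas in `C`, with parameters. -/
def fcp (C : FmClass) : Theory :=
  {σ | ∃ (k n : ℕ) (φ : Fm (k + 1) n), C φ ∧ σ = ((finCharFm φ).imp (maximalFm φ)).close}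

/-- The finite character principle for formulas in `S` that are equivalent to a formula in `P`. -/
def fcpDelta (S P : FmClass) : Theory :=
  {σ | ∃ (k n : ℕ) (φ ψ : Fm (k + 1) n), S φ ∧ P ψ ∧
    σ = (Fm.imp (.and (finCharFm φ) (.allS (φ.iff ψ))) (maximalFm φ)).close}

/-- The names of the classes `Σ⁰ₘ, Π⁰ₘ, Δ⁰ₘ` and `Σ¹ₘ, Π¹ₘ, Δ¹ₘ`, the latter three in one of
the two readings. -/
inductive Gam
  | sigma0 (m : ℕ)
  | pi0 (m : ℕ)
  | delta0 (m : ℕ)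
  | sigma1 (r : Reading) (m : ℕ)
  | pi1 (r : Reading) (m : ℕ)
  | delta1 (r : Reading) (m : ℕ)

/-- The scheme `Γ-CA`. -/
def CA : Gam → Theory
  | .sigma0 m => ca (Hier0 .sigma m)
  | .pi0 m => ca (Hier0 .pi m)
  | .delta0 m => caDelta (Hier0 .sigma m) (Hier0 .pi m)
  | .sigma1 r m => ca (Hier1 r .sigma m)
  | .pi1 r m => ca (Hier1 r .pi m)
  | .delta1 r m => caDelta (Hier1 r .sigma m) (Hier1 r .pi m)

/-- The scheme `Γ-FCP`. -/
def FCP : Gam → Theory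
  | .sigma0 m => fcp (Hier0 .sigma m)
  | .pi0 m => fcp (Hier0 .pi m)
  | .delta0 m => fcpDelta (Hier0 .sigma m) (Hier0 .pi m)
  | .sigma1 r m => fcp (Hier1 r .sigma m)
  | .pi1 r m => fcp (Hier1 r .pi m)
  | .delta1 r m => fcpDelta (Hier1 r .sigma m) (Hier1 r .pi m)

/-- `QF-FCP`: quantifier-free formulas without parameters. -/
def FCPQF : Theory :=
  {σ | ∃ φ : Fm 1 0, IsQF φ ∧ σ = (finCharFm φ).imp (maximalFm φ)}

/-- Full `FCP`, for arbitrary formulas. -/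
def FCPFull : Theory := fcp fun _ => True

/-! ### Subsystems of second-order arithmetic -/

/-- The axioms of discretely ordered semirings. -/
def basicAxioms : Theory :=
  let x : Tm 3 := .var 0
  let y : Tm 3 := .var 1
  let z : Tm 3 := .var 2
  Fm.close '' ({
    .eq (.add (.add x y) z) (.add x (.add y z)),
    .eq (.add x y) (.add y x),
    .eq (.mul (.mul x y) z) (.mul x (.mul y z)),
    .eq (.mul x y) (.mul y x),
    .eq (.mul x (.add y z)) (.add (.mul x y) (.mul x z)),
    .eq (.add x .zero) x,
    .eq (.mul x .zero) .zero,
    .eq (.mul x .one) x,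
    .imp (.and (.lt x y) (.lt y z)) (.lt x z),
    .neg (.lt x x),
    .or (.lt x y) (.or (.eq x y) (.lt y x)),
    .imp (.lt x y) (.lt (.add x z) (.add y z)),
    .imp (.and (.lt .zero z) (.lt x y)) (.lt (.mul x z) (.mul y z)),
    .imp (.lt x y) (.exN (.eq (.add x.lift (.var 0)) y.lift)),
    .or (.eq .zero x) (.lt .zero x),
    .lt .zero .one,
    .imp (.lt .zero x) (.or (.eq .one x) (.lt .one x)) } : Set (Fm 0 3))

/-- `RCA₀`. -/
def RCA0 : Theory := basicAxioms ∪ ind (Hier0 .sigma 1) ∪ CA (.delta0 1)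

/-- `Γ-CA₀`. -/
def CA0 (Γ : Gam) : Theory := RCA0 ∪ CA Γ

/-- `ACA₀`. -/
def ACA0 : Theory := RCA0 ∪ ca IsArith

/-- Full second-order arithmetic `Z₂`. -/
def Z2 : Theory := basicAxioms ∪ ca (fun _ => True) ∪ ind (fun _ => True)

end SOA

open SOA

/-!
The argument is carried out inside an arbitrary model `M` of `RCA₀`. Its numbers form a discretely
ordered commutative semiring, for which instances are provided, and sentences of a scheme are
unfolded to statements about the numbers and sets of `M`.

*Comprehension proves the finite character principle.* Finite sets are coded by numbers: `coded p`
is defined by divisibility by the moduli of Gödel's beta function, so that membership is a bounded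
formula, and `exists_code` shows by `Σ⁰₁` induction that every set of `M` is coded below any given
bound. The code `w = pair p y` of the set `topCoded w = (coded p ∩ [0, y)) ∪ {y}` displays the
maximum of the set. Replacing `t ∈ X` by `t ∈ topCoded w` in a formula `φ(X)` keeps `φ` in each of
the classes in question (`Fm.repl`, `ReplClosed`), hence `Γ`-comprehension provides the set `C` of
all `w` with `φ(topCoded w)`. From `C` and a set `A` one obtains, by `Σ⁰₁` induction and `Δ⁰₁`
comprehension, the greedy subset `B` of `A`, which accepts `x ∈ A` if `φ` holds of the set of the
earlier choices together with `x` (`exists_greedy`). Finite character implies that `φ(B)` holds and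
that `B` is maximal (`FiniteCharacter.hasMaximal`).

*The finite character principle proves comprehension.* The property `∀ x ∈ X, θ(x)` of `X` has
finite character, and the only maximal set of numbers with this property is `{x | θ(x)}`. It is
expressed by a formula in the same class as `θ` if this class is closed under universal number
quantification (`GuardedAll`). For strict `Π¹ₘ`, where a number quantifier cannot be moved past set
quantifiers without choice, the quantifier `∀ x` is replaced by a quantifier over the singletons
`{x}`, and relativized to a given singleton a number quantifier does commute with set quantifiers
(`Hier1Strict.exists_forall_singleton`).

*Comparison of the comprehension schemes.* A relation is represented if the codes of its tuples are
singled out by a set of `M`. `Π⁰₁` comprehension makes the represented relations closed under number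
quantification. Hence it yields arithmetical comprehension, and strict `Π¹ₘ` comprehension yields
comprehension for `Σ¹ₘ` and `Π¹ₘ` formulas with a prefix of number quantifiers.
-/

namespace SOA

/-! ### Substitution and satisfaction -/

theorem Tm.val_subst (M : Str.{u}) {n m : ℕ} (σ : Fin n → Tm m) (v : Fin m → M.N) (t : Tm n) :
    (t.subst σ).val M v = t.val M fun i => (σ i).val M v := by
  induction t <;> simp_all [Tm.subst, Tm.val]

theorem Tm.val_lift (M : Str.{u}) {n : ℕ} (t : Tm n) (a : M.N) (v : Fin n → M.N) :
    t.lift.val M (Fin.cons a v) = t.val M v := by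
  simp [Tm.lift, Tm.val_subst, Tm.val]

theorem Tm.subst_lift {n m : ℕ} (σ : Fin n → Tm m) (t : Tm n) :
    t.lift.subst (Fin.cons (.var 0) fun i => (σ i).lift) = (t.subst σ).lift := by
  induction t <;> simp_all [Tm.subst, Tm.lift]

theorem Tm.val_lift_cons (M : Str.{u}) {n m : ℕ} (σ : Fin n → Tm m) (a : M.N) (v : Fin m → M.N) :
    (fun i => Tm.val M (Fin.cons a v)
      ((Fin.cons (.var 0) fun i => (σ i).lift : Fin (n + 1) → Tm (m + 1)) i)) =
      Fin.cons a fun i => (σ i).val M v := by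
  funext i
  refine Fin.cases ?_ (fun i => ?_) i
  · simp [Tm.val]
  · simp [Tm.val_lift]

theorem cons_comp_cons {α : Type*} {k k' : ℕ} (f : Fin k → Fin k') (A : α) (V : Fin k' → α) :
    (fun i => (Fin.cons A V : Fin (k' + 1) → α)
      ((Fin.cons 0 fun i => (f i).succ : Fin (k + 1) → Fin (k' + 1)) i)) =
      Fin.cons A fun i => V (f i) := by
  funext i
  refine Fin.cases ?_ (fun i => ?_) i <;> simp

theorem Fm.sat_subst (M : Str.{u}) {k n : ℕ} (φ : Fm k n) : ∀ {k' n' : ℕ} (f : Fin k → Fin k')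
    (σ : Fin n → Tm n') (V : Fin k' → M.sets) (v : Fin n' → M.N),
    (φ.subst f σ).Sat M V v ↔ φ.Sat M (fun i => V (f i)) fun i => (σ i).val M v := by
  induction φ with
  | eq s t => intros; simp [Fm.subst, Fm.Sat, Tm.val_subst]
  | lt s t => intros; simp [Fm.subst, Fm.Sat, Tm.val_subst]
  | mem t X => intros; simp [Fm.subst, Fm.Sat, Tm.val_subst]
  | neg φ ih => intros; simp [Fm.subst, Fm.Sat, ih]
  | and φ ψ ih ih' => intros; simp [Fm.subst, Fm.Sat, ih, ih']
  | or φ ψ ih ih' => intros; simp [Fm.subst, Fm.Sat, ih, ih']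
  | allN φ ih => intros; simp only [Fm.subst, Fm.Sat, ih, Tm.val_lift_cons]
  | exN φ ih => intros; simp only [Fm.subst, Fm.Sat, ih, Tm.val_lift_cons]
  | allS φ ih => intros; simp only [Fm.subst, Fm.Sat, ih, cons_comp_cons]
  | exS φ ih => intros; simp only [Fm.subst, Fm.Sat, ih, cons_comp_cons]

section Sat

variable {M : Str.{u}} {k n : ℕ}

theorem sat_imp {φ ψ : Fm k n} {V : Fin k → M.sets} {v : Fin n → M.N} :
    (φ.imp ψ).Sat M V v ↔ (φ.Sat M V v → ψ.Sat M V v) := by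
  simp only [Fm.imp, Fm.Sat]
  tauto

theorem sat_iff {φ ψ : Fm k n} {V : Fin k → M.sets} {v : Fin n → M.N} :
    (φ.iff ψ).Sat M V v ↔ (φ.Sat M V v ↔ ψ.Sat M V v) := by
  simp only [Fm.iff, Fm.Sat, sat_imp]
  tauto

theorem sat_closeN {k n : ℕ} {φ : Fm k n} {V : Fin k → M.sets} :
    φ.closeN.Sat M V Fin.elim0 ↔ ∀ v, φ.Sat M V v := by
  induction n with
  | zero => exact ⟨fun h v => by rwa [Subsingleton.elim v Fin.elim0], fun h => h _⟩
  | succ n ih =>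
    rw [Fm.closeN, ih]
    exact ⟨fun h v => by simpa using h (Fin.tail v) (v 0), fun h v a => h _⟩

theorem sat_closeS {k : ℕ} {φ : Fm k 0} :
    φ.closeS.Sat M Fin.elim0 Fin.elim0 ↔ ∀ V, φ.Sat M V Fin.elim0 := by
  induction k with
  | zero => exact ⟨fun h v => by rwa [Subsingleton.elim v Fin.elim0], fun h => h _⟩
  | succ n ih =>
    rw [Fm.closeS, ih]
    exact ⟨fun h v => by simpa using h (Fin.tail v) (v 0), fun h v a => h _⟩

theorem sat_close {φ : Fm k n} :
    φ.close.Sat M Fin.elim0 Fin.elim0 ↔ ∀ V v, φ.Sat M V v := by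
  simp only [Fm.close, sat_closeS, sat_closeN]

theorem sat_weaken {φ : Fm k n} {A : M.sets} {V : Fin k → M.sets} {v : Fin n → M.N} :
    (φ.subst Fin.succ .var).Sat M (Fin.cons A V) v ↔ φ.Sat M V v := by
  simp [Fm.sat_subst, Tm.val]

theorem sat_weakenN {φ : Fm k n} {x : M.N} {V : Fin k → M.sets} {v : Fin n → M.N} :
    (φ.subst id fun i => .var i.succ).Sat M V (Fin.cons x v) ↔ φ.Sat M V v := by
  simp [Fm.sat_subst, Tm.val]

/-- The comprehension axiom for `φ` says that the set which `φ` defines is in the structure. -/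
theorem sat_caFm {φ : Fm k (n + 1)} {V : Fin k → M.sets} {v : Fin n → M.N} :
    (caFm φ).Sat M V v ↔ {x | φ.Sat M V (Fin.cons x v)} ∈ M.sets := by
  simp only [caFm, Fm.Sat, sat_iff, sat_weaken, Tm.val, Fin.cons_zero]
  constructor
  · rintro ⟨A, h⟩
    convert A.2 using 1
    ext x
    exact (h x).symm
  · intro h
    exact ⟨⟨_, h⟩, fun x => Iff.rfl⟩

theorem sat_indFm {φ : Fm k (n + 1)} {V : Fin k → M.sets} {v : Fin n → M.N} :
    (indFm φ).Sat M V v ↔ (φ.Sat M V (Fin.cons M.zero v) →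
      (∀ x, φ.Sat M V (Fin.cons x v) → φ.Sat M V (Fin.cons (M.add x M.one) v)) →
      ∀ x, φ.Sat M V (Fin.cons x v)) := by
  have h0 : (fun i => Tm.val M v ((Fin.cons .zero .var : Fin (n + 1) → Tm n) i)) =
      Fin.cons M.zero v := by
    funext i
    refine Fin.cases ?_ (fun i => ?_) i <;> simp [Tm.val]
  have h1 (x : M.N) : (fun i => Tm.val M (Fin.cons x v)
      ((Fin.cons (.add (.var 0) .one) fun i => .var i.succ : Fin (n + 1) → Tm (n + 1)) i)) =
      Fin.cons (M.add x M.one) v := by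
    funext i
    refine Fin.cases ?_ (fun i => ?_) i <;> simp [Tm.val]
  simp only [indFm, sat_imp, Fm.Sat, Fm.sat_subst, h0, h1, id, and_imp]

/-- Finite character of a property of the sets of a structure. -/
def FiniteCharacter (M : Str.{u}) (Φ : M.sets → Prop) : Prop :=
  (∀ A : M.sets, A.1 = ∅ → Φ A) ∧
    ∀ A : M.sets, Φ A ↔
      ∀ F : M.sets, F.1 ⊆ A.1 → (∃ b, ∀ x ∈ F.1, M.lt x b) → Φ F

theorem sat_finCharFm {φ : Fm (k + 1) n} {V : Fin k → M.sets} {v : Fin n → M.N} :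
    (finCharFm φ).Sat M V v ↔ FiniteCharacter M fun A => φ.Sat M (Fin.cons A V) v := by
  have h (A F : M.sets) : (fun i => (Fin.cons F (Fin.cons A V) : Fin (k + 2) → M.sets)
      ((Fin.cons 0 fun i => i.succ.succ : Fin (k + 1) → Fin (k + 2)) i)) = Fin.cons F V := by
    funext i
    refine Fin.cases ?_ (fun i => ?_) i <;> simp
  simp only [finCharFm, FiniteCharacter, Fm.Sat, sat_imp, sat_iff, emptyFm, subFm, finFm, skip1,
    Fm.sat_subst, Tm.val, h, Set.subset_def, Set.eq_empty_iff_forall_notMem, and_imp]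
  rfl

/-- Every set has a maximal subset with the property `Φ`. -/
def HasMaximal (M : Str.{u}) (Φ : M.sets → Prop) : Prop :=
  ∀ A : M.sets, ∃ B : M.sets, B.1 ⊆ A.1 ∧ Φ B ∧
    ∀ C : M.sets, B.1 ⊆ C.1 → C.1 ⊆ A.1 → Φ C → C.1 ⊆ B.1

theorem sat_maximalFm {φ : Fm (k + 1) n} {V : Fin k → M.sets} {v : Fin n → M.N} :
    (maximalFm φ).Sat M V v ↔ HasMaximal M fun A => φ.Sat M (Fin.cons A V) v := by
  have h (A F : M.sets) : (fun i => (Fin.cons F (Fin.cons A V) : Fin (k + 2) → M.sets)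
      ((Fin.cons 0 fun i => i.succ.succ : Fin (k + 1) → Fin (k + 2)) i)) = Fin.cons F V := by
    funext i
    refine Fin.cases ?_ (fun i => ?_) i <;> simp
  have h' (A F C : M.sets) : (fun i =>
      (Fin.cons C (Fin.cons F (Fin.cons A V)) : Fin (k + 3) → M.sets)
      ((Fin.cons 0 fun i => i.succ.succ.succ : Fin (k + 1) → Fin (k + 3)) i)) = Fin.cons C V := by
    funext i
    refine Fin.cases ?_ (fun i => ?_) i <;> simp
  simp only [maximalFm, HasMaximal, Fm.Sat, sat_imp, subFm, skip1, skip2,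
    Fm.sat_subst, Tm.val, h, h', Set.subset_def, and_imp, and_assoc]
  rfl

end Sat

/-! ### The schemes in a structure -/

section Schemes

variable {M : Str.{u}}

theorem models_union {T U : Theory} : M.Models (T ∪ U) ↔ M.Models T ∧ M.Models U := by
  simp only [Str.Models, Set.mem_union]
  exact ⟨fun h => ⟨fun φ hφ => h φ (.inl hφ), fun φ hφ => h φ (.inr hφ)⟩,
    fun h φ hφ => hφ.elim (h.1 φ) (h.2 φ)⟩

theorem models_ind {C : FmClass} : M.Models (ind C) ↔
    ∀ {k n : ℕ} (φ : Fm k (n + 1)), C φ → ∀ V v, (indFm φ).Sat M V v := by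
  constructor
  · exact fun h k n φ hφ => sat_close.1 (h _ ⟨k, n, φ, hφ, rfl⟩)
  · rintro h _ ⟨k, n, φ, hφ, rfl⟩
    exact sat_close.2 (h φ hφ)

theorem models_ca {C : FmClass} : M.Models (ca C) ↔
    ∀ {k n : ℕ} (φ : Fm k (n + 1)), C φ → ∀ V v, {x | φ.Sat M V (Fin.cons x v)} ∈ M.sets := by
  constructor
  · exact fun h k n φ hφ V v => sat_caFm.1 (sat_close.1 (h _ ⟨k, n, φ, hφ, rfl⟩) V v)
  · rintro h _ ⟨k, n, φ, hφ, rfl⟩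
    exact sat_close.2 fun V v => sat_caFm.2 (h φ hφ V v)

theorem models_caDelta {S P : FmClass} : M.Models (caDelta S P) ↔
    ∀ {k n : ℕ} (φ ψ : Fm k (n + 1)), S φ → P ψ → ∀ V v,
      (∀ x, φ.Sat M V (Fin.cons x v) ↔ ψ.Sat M V (Fin.cons x v)) →
      {x | φ.Sat M V (Fin.cons x v)} ∈ M.sets := by
  constructor
  · intro h k n φ ψ hφ hψ V v hx
    have := sat_close.1 (h _ ⟨k, n, φ, ψ, hφ, hψ, rfl⟩) V v
    rw [sat_imp, sat_caFm] at this
    exact this fun x => sat_iff.2 (hx x)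
  · rintro h _ ⟨k, n, φ, ψ, hφ, hψ, rfl⟩
    refine sat_close.2 fun V v => sat_imp.2 fun hx => sat_caFm.2 (h φ ψ hφ hψ V v ?_)
    exact fun x => sat_iff.1 (hx x)

theorem models_fcp {C : FmClass} : M.Models (fcp C) ↔
    ∀ {k n : ℕ} (φ : Fm (k + 1) n), C φ → ∀ V v,
      FiniteCharacter M (fun A => φ.Sat M (Fin.cons A V) v) →
      HasMaximal M fun A => φ.Sat M (Fin.cons A V) v := by
  constructor
  · intro h k n φ hφ V v
    have := sat_close.1 (h _ ⟨k, n, φ, hφ, rfl⟩) V v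
    rwa [sat_imp, sat_finCharFm, sat_maximalFm] at this
  · rintro h _ ⟨k, n, φ, hφ, rfl⟩
    refine sat_close.2 fun V v => ?_
    rw [sat_imp, sat_finCharFm, sat_maximalFm]
    exact h φ hφ V v

theorem models_fcpDelta {S P : FmClass} : M.Models (fcpDelta S P) ↔
    ∀ {k n : ℕ} (φ ψ : Fm (k + 1) n), S φ → P ψ → ∀ V v,
      FiniteCharacter M (fun A => φ.Sat M (Fin.cons A V) v) →
      (∀ A : M.sets, φ.Sat M (Fin.cons A V) v ↔ ψ.Sat M (Fin.cons A V) v) →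
      HasMaximal M fun A => φ.Sat M (Fin.cons A V) v := by
  constructor
  · intro h k n φ ψ hφ hψ V v h1 h2
    have := sat_close.1 (h _ ⟨k, n, φ, ψ, hφ, hψ, rfl⟩) V v
    rw [sat_imp, Fm.Sat, sat_finCharFm, sat_maximalFm] at this
    exact this ⟨h1, fun A => sat_iff.2 (h2 A)⟩
  · rintro h _ ⟨k, n, φ, ψ, hφ, hψ, rfl⟩
    refine sat_close.2 fun V v => ?_
    rw [sat_imp, Fm.Sat, sat_finCharFm, sat_maximalFm]
    exact fun hh => h φ ψ hφ hψ V v hh.1 fun A => sat_iff.1 (hh.2 A)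

theorem models_ca_mono {C D : FmClass} (hM : M.Models (ca D))
    (hCD : ∀ {k n : ℕ} {φ : Fm k n}, C φ → D φ) : M.Models (ca C) :=
  models_ca.2 fun φ hφ => models_ca.1 hM φ (hCD hφ)

end Schemes

/-! ### Arithmetic of discretely ordered semirings -/

section Semiring

set_option linter.unusedSectionVars false

variable {N : Type u} [CommSemiring N] [LinearOrder N] [IsStrictOrderedRing N]
  [CanonicallyOrderedAdd N] [SuccAddOrder N]

/-- A polynomial pairing function. -/
def pair (x y : N) : N := (x + y) * (x + y) + x

theorem left_le_pair (x y : N) : x ≤ pair x y := le_add_self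

theorem le_mul_self_of_discrete (x : N) : x ≤ x * x := by
  rcases eq_zero_or_pos x with rfl | h
  · simp
  · exact le_mul_of_one_le_left' (Order.one_le_iff_pos.2 h)

theorem right_le_pair (x y : N) : y ≤ pair x y :=
  (le_add_self.trans (le_mul_self_of_discrete (x + y))).trans le_self_add

theorem add_le_of_pair_eq {x y x' y' : N} (h : pair x y = pair x' y') : x + y ≤ x' + y' := by
  by_contra! hlt
  have h1 : x' + y' + 1 ≤ x + y := Order.add_one_le_iff.2 hlt
  have h2 : (x' + y' + 1) * (x' + y' + 1) ≤ (x + y) * (x + y) := mul_le_mul' h1 h1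
  have h3 : (x' + y' + 1) * (x' + y' + 1) = pair x' y' + (x' + y' + y' + 1) := by
    unfold pair; ring
  have h4 : (x + y) * (x + y) ≤ pair x y := le_self_add
  have h5 : pair x' y' < pair x' y' + (x' + y' + y' + 1) :=
    lt_add_of_pos_right _ (by positivity)
  rw [h3] at h2
  exact absurd (h5.trans_le (h2.trans (h4.trans h.le))) (lt_irrefl _)

theorem pair_inj {x y x' y' : N} : pair x y = pair x' y' ↔ x = x' ∧ y = y' := by
  refine ⟨fun h => ?_, by rintro ⟨rfl, rfl⟩; rfl⟩
  have hs : x + y = x' + y' := (add_le_of_pair_eq h).antisymm (add_le_of_pair_eq h.symm)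
  have hx : x = x' := by
    unfold pair at h
    rw [hs] at h
    exact add_left_cancel h
  subst hx
  exact ⟨rfl, add_left_cancel hs⟩

theorem dvd_of_dvd_add {m u v : N} (h : m ∣ u + v) (hu : m ∣ u) : m ∣ v := by
  obtain ⟨s, hs⟩ := h
  obtain ⟨t, rfl⟩ := hu
  rcases le_total t s with hts | hts
  · obtain ⟨r, rfl⟩ := exists_add_of_le hts
    rw [mul_add] at hs
    exact ⟨r, add_left_cancel hs⟩
  · obtain ⟨r, rfl⟩ := exists_add_of_le hts
    have : m * s + (m * r + v) = m * s + 0 := by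
      rw [add_zero, ← add_assoc, ← mul_add, hs]
    have := add_left_cancel this
    have hv : v = 0 := le_antisymm (this ▸ le_add_self) (zero_le (a := v))
    exact hv ▸ dvd_zero m

/-- The moduli `1 + (x + 1) b` of Gödel's beta function: if `b` is divisible by the distance of
`x` and `y`, then the modulus of `x` is coprime to that of `y`, in the sense of Euclid's lemma. -/
theorem modulus_dvd_of_dvd_mul {b x y d : N} (a : N) (hd : d ∣ b) (hxy : y = x + d ∨ x = y + d)
    (h : 1 + (x + 1) * b ∣ a * (1 + (y + 1) * b)) : 1 + (x + 1) * b ∣ a := by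
  obtain ⟨e, rfl⟩ := hd
  -- Modulo `m = 1 + (x + 1) b`, the modulus of `y` is `± d b`, and `b` is invertible.
  have cancel {u : N} (hu : 1 + (x + 1) * (d * e) ∣ u * (d * e)) :
      1 + (x + 1) * (d * e) ∣ u := by
    refine dvd_of_dvd_add (u := (x + 1) * (u * (d * e))) ?_ (hu.mul_left _)
    exact ⟨u, by ring⟩
  have key : 1 + (x + 1) * (d * e) ∣ a * d * (d * e) := by
    rcases hxy with rfl | rfl
    · refine dvd_of_dvd_add (u := a * (1 + (x + 1) * (d * e))) ?_ ⟨a, by ring⟩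
      convert h using 1
      ring
    · refine dvd_of_dvd_add ?_ h
      exact ⟨a, by ring⟩
  apply cancel
  have := (cancel key).mul_right e
  rwa [mul_assoc] at this

end Semiring

/-! ### The numbers of a model as a semiring -/

section Instances

variable {M : Str.{u}}

theorem models_RCA0 : M.Models RCA0 ↔ M.Models basicAxioms ∧ M.Models (ind (Hier0 .sigma 1)) ∧
    M.Models (CA (.delta0 1)) := by
  rw [RCA0, models_union, models_union, and_assoc]

theorem forall_fin_three {p : (Fin 3 → M.N) → Prop} :
    (∀ v, p v) ↔ ∀ x y z, p ![x, y, z] :=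
  ⟨fun h x y z => h _, fun h v => by
    have := h (v 0) (v 1) (v 2)
    convert this using 1
    ext i; fin_cases i <;> rfl⟩

/-- The axioms of discretely ordered semirings, in semantic form. -/
structure Str.Basic (M : Str.{u}) : Prop where
  add_assoc : ∀ x y z, M.add (M.add x y) z = M.add x (M.add y z)
  add_comm : ∀ x y, M.add x y = M.add y x
  mul_assoc : ∀ x y z, M.mul (M.mul x y) z = M.mul x (M.mul y z)
  mul_comm : ∀ x y, M.mul x y = M.mul y x
  mul_add : ∀ x y z, M.mul x (M.add y z) = M.add (M.mul x y) (M.mul x z)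
  add_zero : ∀ x, M.add x M.zero = x
  mul_zero : ∀ x, M.mul x M.zero = M.zero
  mul_one : ∀ x, M.mul x M.one = x
  lt_trans : ∀ x y z, M.lt x y → M.lt y z → M.lt x z
  lt_irrefl : ∀ x, ¬ M.lt x x
  lt_trichotomy : ∀ x y, M.lt x y ∨ x = y ∨ M.lt y x
  add_lt_add : ∀ x y z, M.lt x y → M.lt (M.add x z) (M.add y z)
  mul_lt_mul : ∀ x y z, M.lt M.zero z → M.lt x y → M.lt (M.mul x z) (M.mul y z)
  exists_add : ∀ x y, M.lt x y → ∃ z, M.add x z = y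
  zero_le : ∀ x, M.zero = x ∨ M.lt M.zero x
  zero_lt_one : M.lt M.zero M.one
  one_le : ∀ x, M.lt M.zero x → M.one = x ∨ M.lt M.one x

theorem Str.Models.basic (h : M.Models basicAxioms) : M.Basic := by
  simp only [Str.Models, basicAxioms, Set.forall_mem_image, Set.forall_mem_insert,
    Set.mem_singleton_iff, forall_eq, sat_close, forall_fin_three, Fm.Sat, sat_imp, Tm.val,
    Tm.val_lift, Fin.cons_zero, forall_const] at h
  simp only [Matrix.cons_val] at h
  obtain ⟨h1, h2, h3, h4, h5, h6, h7, h8, h9, h10, h11, h12, h13, h14, h15, h16, h17⟩ := h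
  have o := M.zero
  exact ⟨h1, fun x y => h2 x y o, h3, fun x y => h4 x y o, h5, fun x => h6 x o o,
    fun x => h7 x o o, fun x => h8 x o o, fun x y z hxy hyz => h9 x y z ⟨hxy, hyz⟩,
    fun x => h10 x o o, fun x y => h11 x y o, h12, fun x y z hz hxy => h13 x y z ⟨hz, hxy⟩,
    fun x y => h14 x y o, fun x => h15 x o o, h16 o o o, fun x => h17 x o o⟩

/-- The semiring of numbers of a model of the basic axioms. -/
instance [h : Fact (M.Models RCA0)] : CommSemiring M.N :=
  have b := (models_RCA0.1 h.out).1.basic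
  { add := M.add
    mul := M.mul
    zero := M.zero
    one := M.one
    add_assoc := b.add_assoc
    add_comm := b.add_comm
    zero_add := fun x => (b.add_comm _ _).trans (b.add_zero x)
    add_zero := b.add_zero
    mul_assoc := b.mul_assoc
    mul_comm := b.mul_comm
    one_mul := fun x => (b.mul_comm _ _).trans (b.mul_one x)
    mul_one := b.mul_one
    zero_mul := fun x => (b.mul_comm _ _).trans (b.mul_zero x)
    mul_zero := b.mul_zero
    left_distrib := b.mul_add
    right_distrib := fun x y z => by
      change M.mul (M.add x y) z = M.add (M.mul x z) (M.mul y z)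
      rw [b.mul_comm, b.mul_add, b.mul_comm z, b.mul_comm z]
    nsmul := @nsmulRec _ ⟨M.zero⟩ ⟨M.add⟩
    nsmul_zero := fun _ => rfl
    nsmul_succ := fun _ _ => rfl
    npow := @npowRec _ ⟨M.one⟩ ⟨M.mul⟩
    npow_zero := fun _ => rfl
    npow_succ := fun _ _ => rfl }

open Classical in
/-- The order of the numbers of a model of the basic axioms. -/
noncomputable instance [h : Fact (M.Models RCA0)] : LinearOrder M.N :=
  have b := (models_RCA0.1 h.out).1.basic
  { lt := M.lt
    le := fun x y => M.lt x y ∨ x = y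
    le_refl := fun x => .inr rfl
    le_trans := by
      rintro x y z (hxy | rfl) (hyz | rfl)
      · exact .inl (b.lt_trans _ _ _ hxy hyz)
      · exact .inl hxy
      · exact .inl hyz
      · exact .inr rfl
    le_antisymm := by
      rintro x y (hxy | rfl) (hyx | h)
      · exact (b.lt_irrefl _ (b.lt_trans _ _ _ hxy hyx)).elim
      · exact h.symm
      · rfl
      · rfl
    lt_iff_le_not_ge := fun x y => by
      refine ⟨fun hxy => ⟨.inl hxy, ?_⟩, fun hxy => hxy.1.resolve_right ?_⟩
      · rintro (hyx | rfl)
        · exact b.lt_irrefl _ (b.lt_trans _ _ _ hxy hyx)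
        · exact b.lt_irrefl _ hxy
      · rintro rfl
        exact hxy.2 (.inr rfl)
    le_total := fun x y => by
      rcases b.lt_trichotomy x y with h | rfl | h
      · exact .inl (.inl h)
      · exact .inl (.inr rfl)
      · exact .inr (.inl h)
    toDecidableLE := Classical.decRel _ }

variable [h : Fact (M.Models RCA0)]

theorem Str.basic : M.Basic := (models_RCA0.1 h.out).1.basic

@[simp] theorem Str.add_eq (x y : M.N) : M.add x y = x + y := rfl
@[simp] theorem Str.zero_eq : M.zero = 0 := rfl
@[simp] theorem Str.one_eq : M.one = 1 := rfl
@[simp] theorem Str.lt_iff {x y : M.N} : M.lt x y ↔ x < y := Iff.rfl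

instance : CanonicallyOrderedAdd M.N where
  exists_add_of_le := by
    intro x y hxy
    rcases hxy with hxy | rfl
    · obtain ⟨z, hz⟩ := Str.basic.exists_add _ _ hxy
      exact ⟨z, hz.symm⟩
    · exact ⟨0, (add_zero x).symm⟩
  le_self_add := by
    intro x y
    rcases Str.basic.zero_le y with hy | hy
    · exact .inr (by rw [← hy]; exact (add_zero x).symm)
    · left
      have := Str.basic.add_lt_add _ _ x hy
      simp only [Str.add_eq, Str.zero_eq, zero_add, Str.lt_iff] at this
      rwa [add_comm] at this
  le_add_self := by
    intro x y
    rw [add_comm]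
    rcases Str.basic.zero_le y with hy | hy
    · exact .inr (by rw [← hy]; exact (add_zero x).symm)
    · left
      have := Str.basic.add_lt_add _ _ x hy
      simp only [Str.add_eq, Str.zero_eq, zero_add, Str.lt_iff] at this
      rwa [add_comm] at this

instance : IsStrictOrderedRing M.N :=
  have hadd : ∀ x y z : M.N, x < y → z + x < z + y := fun x y z hxy => by
    simpa [add_comm] using Str.basic.add_lt_add _ _ z hxy
  have : IsOrderedCancelAddMonoid M.N :=
    { add_le_add_left := fun x y hxy z => by
        rcases hxy.lt_or_eq with h | rfl
        · have := (hadd _ _ z h).le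
          rwa [add_comm, add_comm y]
        · exact le_rfl
      le_of_add_le_add_left := fun z x y hxy => by
        by_contra! h
        exact absurd ((hadd _ _ z h).trans_le hxy) (lt_irrefl _) }
  have : Nontrivial M.N := ⟨0, 1, fun h01 => by
    have := Str.basic (M := M).zero_lt_one
    simp [← h01] at this⟩
  have hmul : ∀ x y z : M.N, 0 < z → x < y → x * z < y * z := Str.basic.mul_lt_mul
  { zero_le_one := zero_le
    mul_lt_mul_of_pos_left := fun z hz x y hxy => by
      simpa [mul_comm] using hmul x y z hz hxy
    mul_lt_mul_of_pos_right := fun z hz x y hxy => hmul x y z hz hxy }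

noncomputable instance : SuccAddOrder M.N where
  succ x := x + 1
  le_succ x := le_self_add
  max_of_succ_le {x} hx := by
    have : (0 : M.N) < 1 := Str.basic.zero_lt_one
    exact absurd ((lt_add_of_pos_right x this).trans_le hx) (lt_irrefl _)
  succ_le_of_lt {x y} hxy := by
    obtain ⟨z, rfl⟩ := exists_add_of_le hxy.le
    have hz : 0 < z := pos_of_lt_add_right hxy
    rcases Str.basic.one_le z hz with rfl | h
    · exact le_rfl
    · exact add_le_add_right (le_of_lt h) x
  succ_eq_add_one _ := rfl

end Instances

/-! ### Bounded formulas -/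

/-- The bounded quantifier `∀ x < t`. -/
def Fm.ball {k n : ℕ} (t : Tm n) (φ : Fm k (n + 1)) : Fm k n := .allN (.imp (.lt (.var 0) t.lift) φ)

/-- The bounded quantifier `∃ x < t`. -/
def Fm.bex {k n : ℕ} (t : Tm n) (φ : Fm k (n + 1)) : Fm k n := .exN (.and (.lt (.var 0) t.lift) φ)

theorem IsBdd.imp {k n : ℕ} {φ ψ : Fm k n} (hφ : IsBdd φ) (hψ : IsBdd ψ) : IsBdd (φ.imp ψ) :=
  .or (.neg hφ) hψ

theorem IsBdd.iff {k n : ℕ} {φ ψ : Fm k n} (hφ : IsBdd φ) (hψ : IsBdd ψ) : IsBdd (φ.iff ψ) :=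
  .and (hφ.imp hψ) (hψ.imp hφ)

theorem IsBdd.subst {k n : ℕ} {φ : Fm k n} (h : IsBdd φ) : ∀ {k' n' : ℕ} (f : Fin k → Fin k')
    (σ : Fin n → Tm n'), IsBdd (φ.subst f σ) := by
  induction h with
  | eq s t => exact fun _ _ => .eq _ _
  | lt s t => exact fun _ _ => .lt _ _
  | mem t X => exact fun _ _ => .mem _ _
  | neg _ ih => exact fun f σ => .neg (ih f σ)
  | and _ _ ih ih' => exact fun f σ => .and (ih f σ) (ih' f σ)
  | or _ _ ih ih' => exact fun f σ => .or (ih f σ) (ih' f σ)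
  | ball t _ ih =>
    intro _ _ f σ
    have := IsBdd.ball (t.subst σ) (ih f (Fin.cons (.var 0) fun i => (σ i).lift))
    rwa [← Tm.subst_lift] at this
  | bex t _ ih =>
    intro _ _ f σ
    have := IsBdd.bex (t.subst σ) (ih f (Fin.cons (.var 0) fun i => (σ i).lift))
    rwa [← Tm.subst_lift] at this

/-- The term for the pairing polynomial. -/
def Tm.pair {n : ℕ} (s t : Tm n) : Tm n := .add (.mul (.add s t) (.add s t)) s

/-- The term `t + 1`. -/
def Tm.succ {n : ℕ} (t : Tm n) : Tm n := .add t .one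

theorem vec_val_two (M : Str.{u}) {n : ℕ} {s t : Tm n} {v : Fin n → M.N} :
    (fun i => ((![s, t] : Fin 2 → Tm n) i).val M v) = ![s.val M v, t.val M v] := by
  funext i
  fin_cases i <;> rfl

section Sat

variable {M : Str.{u}} {k n : ℕ} {V : Fin k → M.sets} {v : Fin n → M.N} {s t : Tm n}
  {φ ψ : Fm k n}

theorem sat_eq : (Fm.eq s t).Sat M V v ↔ s.val M v = t.val M v := Iff.rfl
theorem sat_mem {X : Fin k} : (Fm.mem t X).Sat M V v ↔ t.val M v ∈ (V X).1 := Iff.rfl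
theorem sat_neg : φ.neg.Sat M V v ↔ ¬ φ.Sat M V v := Iff.rfl
theorem sat_and : (φ.and ψ).Sat M V v ↔ φ.Sat M V v ∧ ψ.Sat M V v := Iff.rfl
theorem sat_or : (φ.or ψ).Sat M V v ↔ φ.Sat M V v ∨ ψ.Sat M V v := Iff.rfl
theorem val_var {i : Fin n} : (Tm.var i).val M v = v i := rfl

variable [h : Fact (M.Models RCA0)]

theorem sat_lt : (Fm.lt s t).Sat M V v ↔ s.val M v < t.val M v := Iff.rfl

theorem sat_ball {φ : Fm k (n + 1)} :
    (φ.ball t).Sat M V v ↔ ∀ x < t.val M v, φ.Sat M V (Matrix.vecCons x v) := by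
  simp only [Fm.ball, Fm.Sat, sat_imp, Tm.val_lift, Tm.val, Fin.cons_zero]
  rfl

theorem sat_bex {φ : Fm k (n + 1)} :
    (φ.bex t).Sat M V v ↔ ∃ x < t.val M v, φ.Sat M V (Matrix.vecCons x v) := by
  simp only [Fm.bex, Fm.Sat, Tm.val_lift, Tm.val, Fin.cons_zero]
  rfl

theorem val_zero : (Tm.zero : Tm n).val M v = 0 := rfl
theorem val_one : (Tm.one : Tm n).val M v = 1 := rfl
theorem val_add : (Tm.add s t).val M v = s.val M v + t.val M v := rfl
theorem val_mul : (Tm.mul s t).val M v = s.val M v * t.val M v := rfl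
theorem val_pair : (Tm.pair s t).val M v = pair (s.val M v) (t.val M v) := rfl
theorem val_succ : (Tm.succ t).val M v = t.val M v + 1 := rfl

end Sat

attribute [simp] sat_eq sat_mem sat_neg sat_and sat_or sat_imp sat_iff sat_lt sat_ball sat_bex
  val_var val_zero val_one val_add val_mul val_pair val_succ

/-! ### Induction and comprehension in a model of `RCA₀` -/

section RCA

variable {M : Str.{u}} [h : Fact (M.Models RCA0)]

/-- `Σ⁰₁` induction, for a predicate `∃ y, P x y` with `P` defined by a bounded formula. -/
theorem sigma_induction {k n : ℕ} {φ : Fm k (n + 2)} (hφ : IsBdd φ) (V : Fin k → M.sets)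
    (v : Fin n → M.N) {P : M.N → M.N → Prop}
    (hP : ∀ x y, φ.Sat M V (Matrix.vecCons y (Matrix.vecCons x v)) ↔ P x y)
    (h0 : ∃ y, P 0 y) (hs : ∀ x, (∃ y, P x y) → ∃ y, P (x + 1) y) (x : M.N) : ∃ y, P x y := by
  have := models_ind.1 (models_RCA0.1 h.out).2.1 (.exN φ) (.ex (.up (.base hφ))) V v
  rw [sat_indFm] at this
  have key : ∀ x, (Fm.exN φ).Sat M V (Fin.cons x v) ↔ ∃ y, P x y :=
    fun x => exists_congr fun y => hP x y
  simp only [key] at this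
  exact this h0 hs x

theorem bdd_induction {k n : ℕ} {φ : Fm k (n + 1)} (hφ : IsBdd φ) (V : Fin k → M.sets)
    (v : Fin n → M.N) {P : M.N → Prop}
    (hP : ∀ x, φ.Sat M V (Matrix.vecCons x v) ↔ P x)
    (h0 : P 0) (hs : ∀ x, P x → P (x + 1)) (x : M.N) : P x := by
  have := models_ind.1 (models_RCA0.1 h.out).2.1 φ (.up (.base hφ)) V v
  rw [sat_indFm] at this
  have key : ∀ x, φ.Sat M V (Fin.cons x v) ↔ P x := hP
  simp only [key] at this
  exact this h0 hs x

/-- `Δ⁰₁` comprehension, for equivalent predicates `∃ y, P x y` and `∀ y, Q x y` with `P` and `Q`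
defined by bounded formulas. -/
theorem delta_comprehension {k n : ℕ} {φ ψ : Fm k (n + 2)} (hφ : IsBdd φ) (hψ : IsBdd ψ)
    (V : Fin k → M.sets) (v : Fin n → M.N) {P Q : M.N → M.N → Prop}
    (hP : ∀ x y, φ.Sat M V (Matrix.vecCons y (Matrix.vecCons x v)) ↔ P x y)
    (hQ : ∀ x y, ψ.Sat M V (Matrix.vecCons y (Matrix.vecCons x v)) ↔ Q x y)
    (hPQ : ∀ x, (∃ y, P x y) ↔ ∀ y, Q x y) : {x | ∃ y, P x y} ∈ M.sets := by
  have := models_caDelta.1 (models_RCA0.1 h.out).2.2 (.exN φ) (.allN ψ) (.ex (.up (.base hφ)))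
    (.all (.up (.base hψ))) V v
  have key : ∀ x, (Fm.exN φ).Sat M V (Fin.cons x v) ↔ ∃ y, P x y :=
    fun x => exists_congr fun y => hP x y
  have key' : ∀ x, (Fm.allN ψ).Sat M V (Fin.cons x v) ↔ ∀ y, Q x y :=
    fun x => forall_congr' fun y => hQ x y
  simp only [key, key'] at this
  exact this hPQ

theorem bdd_comprehension {k n : ℕ} {φ : Fm k (n + 1)} (hφ : IsBdd φ)
    (V : Fin k → M.sets) (v : Fin n → M.N) {P : M.N → Prop}
    (hP : ∀ x, φ.Sat M V (Matrix.vecCons x v) ↔ P x) : {x | P x} ∈ M.sets := by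
  have := models_caDelta.1 (models_RCA0.1 h.out).2.2 φ φ (.up (.base hφ)) (.up (.base hφ)) V v
    fun _ => Iff.rfl
  have key : ∀ x, φ.Sat M V (Fin.cons x v) ↔ P x := hP
  simpa only [key] using this

theorem set_induction {S : Set M.N} (hS : S ∈ M.sets) (h0 : 0 ∈ S) (hs : ∀ x ∈ S, x + 1 ∈ S)
    (x : M.N) : x ∈ S :=
  bdd_induction (φ := .mem (.var 0) 0) (.mem _ _) ![⟨S, hS⟩] ![] (P := (· ∈ S)) (by simp) h0 hs x

theorem lt_succ_iff {x y : M.N} : x < y + 1 ↔ x ≤ y := Order.lt_add_one_iff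

theorem set_strong_induction {S : Set M.N} (hS : S ∈ M.sets)
    (hs : ∀ x, (∀ y < x, y ∈ S) → x ∈ S) (x : M.N) : x ∈ S := by
  refine hs x (bdd_induction (φ := .ball (.var 0) (.mem (.var 0) 0)) (.ball _ (.mem _ _))
    ![⟨S, hS⟩] ![] (P := fun x => ∀ y < x, y ∈ S) (by simp) ?_ ?_ x)
  · exact fun y hy => absurd hy not_lt_zero
  · intro x hx y hy
    rcases (lt_succ_iff.1 hy).lt_or_eq with h | rfl
    · exact hx y h
    · exact hs y hx

theorem compl_mem_sets {S : Set M.N} (hS : S ∈ M.sets) : Sᶜ ∈ M.sets :=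
  bdd_comprehension (φ := .neg (.mem (.var 0) 0)) (.neg (.mem _ _)) ![⟨S, hS⟩] ![]
    (P := (· ∉ S)) (by simp)

theorem inter_mem_sets {S T : Set M.N} (hS : S ∈ M.sets) (hT : T ∈ M.sets) : S ∩ T ∈ M.sets :=
  bdd_comprehension (φ := .and (.mem (.var 0) 0) (.mem (.var 0) 1)) (.and (.mem _ _) (.mem _ _))
    ![⟨S, hS⟩, ⟨T, hT⟩] ![] (P := fun x => x ∈ S ∧ x ∈ T) (by simp)

theorem univ_mem_sets : (Set.univ : Set M.N) ∈ M.sets :=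
  bdd_comprehension (k := 0) (φ := .eq (.var 0) (.var 0)) (.eq _ _) ![] ![] (P := fun _ => True)
    (by simp)

theorem singleton_mem_sets (x : M.N) : {x} ∈ M.sets :=
  bdd_comprehension (k := 0) (φ := .eq (.var 0) (.var 1)) (.eq _ _) ![] ![x] (P := fun y => y = x)
    (by simp)

end RCA

/-! ### Coding of finite sets by numbers -/

section Coding

variable {M : Str.{u}} [h : Fact (M.Models RCA0)]

/-- The set with code `p = pair a b`: the numbers `x` for which the modulus `1 + (x + 1) b` divides
`a`, as in Gödel's beta function. -/
def coded (p : M.N) : Set M.N := {x | ∃ a b, p = pair a b ∧ 1 + (x + 1) * b ∣ a}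

/-- The bounded formula `x₀ ∈ coded x₁`. -/
def memCodedFm {k : ℕ} : Fm k 2 :=
  .bex (.succ (.var 1)) (.bex (.succ (.var 2)) (.and (.eq (.var 3) (.pair (.var 1) (.var 0)))
    (.bex (.succ (.var 1))
      (.eq (.var 2) (.mul (.add .one (.mul (.succ (.var 3)) (.var 1))) (.var 0))))))

theorem isBdd_memCodedFm {k : ℕ} : IsBdd (memCodedFm : Fm k 2) :=
  .bex _ (.bex _ (.and (.eq _ _) (.bex _ (.eq _ _))))

theorem dvd_iff_exists_le {m a : M.N} (hm : 0 < m) : m ∣ a ↔ ∃ q ≤ a, a = m * q := by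
  refine ⟨?_, fun ⟨q, _, hq⟩ => ⟨q, hq⟩⟩
  rintro ⟨q, rfl⟩
  exact ⟨q, le_mul_of_one_le_left' (Order.one_le_iff_pos.2 hm), rfl⟩

@[simp] theorem sat_memCodedFm {k : ℕ} {V : Fin k → M.sets} {x p : M.N} :
    memCodedFm.Sat M V ![x, p] ↔ x ∈ coded p := by
  have hpos (b : M.N) : 0 < 1 + (x + 1) * b := by positivity
  simp only [memCodedFm, sat_bex, sat_and, sat_eq, val_succ, val_var, val_pair, val_mul, val_add,
    val_one, Matrix.cons_val, coded, Set.mem_ofPred_eq, lt_succ_iff, dvd_iff_exists_le (hpos _)]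
  constructor
  · rintro ⟨a, -, b, -, h⟩
    exact ⟨a, b, h⟩
  · rintro ⟨a, b, rfl, h⟩
    exact ⟨a, left_le_pair _ _, b, right_le_pair _ _, rfl, h⟩

/-- The bounded formula `s ∈ coded t`. -/
def memCodedTm {k n : ℕ} (s t : Tm n) : Fm k n := memCodedFm.subst id ![s, t]

theorem isBdd_memCodedTm {k n : ℕ} {s t : Tm n} : IsBdd (memCodedTm s t : Fm k n) :=
  isBdd_memCodedFm.subst _ _

@[simp] theorem sat_memCodedTm {k n : ℕ} {s t : Tm n} {V : Fin k → M.sets} {v : Fin n → M.N} :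
    (memCodedTm s t).Sat M V v ↔ s.val M v ∈ coded (t.val M v) := by
  simp [memCodedTm, Fm.sat_subst, vec_val_two]

/-- The set with code `w = pair p y` is `(coded p ∩ [0, y)) ∪ {y}`. Thus a code displays the
largest element of the set. -/
def topCoded (w : M.N) : Set M.N := {x | ∃ p y, w = pair p y ∧ (x = y ∨ x < y ∧ x ∈ coded p)}

/-- The bounded formula `s ∈ topCoded t`. -/
def memTopFm {k n : ℕ} (s t : Tm n) : Fm k n :=
  (Fm.bex (.succ (.var 1)) (.bex (.succ (.var 2)) (.and (.eq (.var 3) (.pair (.var 1) (.var 0)))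
    (.or (.eq (.var 2) (.var 0)) (.and (.lt (.var 2) (.var 0))
      (memCodedTm (.var 2) (.var 1)))))) : Fm k 2).subst id ![s, t]

theorem isBdd_memTopFm {k n : ℕ} {s t : Tm n} : IsBdd (memTopFm s t : Fm k n) :=
  IsBdd.subst (.bex _ (.bex _ (.and (.eq _ _) (.or (.eq _ _) (.and (.lt _ _)
    isBdd_memCodedTm))))) _ _

@[simp] theorem sat_memTopFm {k n : ℕ} {s t : Tm n} {V : Fin k → M.sets} {v : Fin n → M.N} :
    (memTopFm s t).Sat M V v ↔ s.val M v ∈ topCoded (t.val M v) := by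
  simp only [memTopFm, Fm.sat_subst, vec_val_two, sat_bex, sat_and, sat_or, sat_lt, sat_eq,
    val_succ, val_var, val_pair, Matrix.cons_val, sat_memCodedTm, topCoded, Set.mem_ofPred_eq,
    lt_succ_iff]
  constructor
  · rintro ⟨a, -, b, -, h⟩
    exact ⟨a, b, h⟩
  · rintro ⟨a, b, h, h'⟩
    exact ⟨a, h ▸ left_le_pair _ _, b, h ▸ right_le_pair _ _, h, h'⟩

theorem mem_topCoded {p x y : M.N} : x ∈ topCoded (pair p y) ↔ x = y ∨ x < y ∧ x ∈ coded p := by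
  constructor
  · rintro ⟨p', y', h, h'⟩
    obtain ⟨rfl, rfl⟩ := pair_inj.1 h
    exact h'
  · exact fun h => ⟨p, y, rfl, h⟩

theorem mem_coded {a b x : M.N} : x ∈ coded (pair a b) ↔ 1 + (x + 1) * b ∣ a := by
  constructor
  · rintro ⟨p', y', h, h'⟩
    obtain ⟨rfl, rfl⟩ := pair_inj.1 h
    exact h'
  · exact fun h => ⟨a, b, rfl, h⟩

theorem topCoded_mem_sets (w : M.N) : topCoded w ∈ M.sets :=
  bdd_comprehension (k := 0) isBdd_memTopFm ![] ![w] (φ := memTopFm (.var 0) (.var 1))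
    (P := (· ∈ topCoded w)) (by simp)

/-- Every number `c` has a common multiple of the positive numbers up to `c`. -/
theorem exists_common_multiple (c : M.N) : ∃ b : M.N, 0 < b ∧ ∀ i < c, i + 1 ∣ b := by
  refine sigma_induction (k := 0) (n := 0) (φ := .and (.lt .zero (.var 0))
    (.ball (.var 1) (.bex (.succ (.var 1)) (.eq (.var 2) (.mul (.succ (.var 1)) (.var 0))))))
    (.and (.lt _ _) (.ball _ (.bex _ (.eq _ _)))) ![] ![]
    (P := fun c b => 0 < b ∧ ∀ i < c, i + 1 ∣ b) ?_ ?_ ?_ c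
  · intro c b
    simp [dvd_iff_exists_le]
  · exact ⟨1, zero_lt_one, fun i hi => absurd hi not_lt_zero⟩
  · rintro c ⟨b, hb, h⟩
    refine ⟨b * (c + 1), by positivity, fun i hi => ?_⟩
    rcases (lt_succ_iff.1 hi).lt_or_eq with hi | rfl
    · exact (h i hi).mul_right _
    · exact dvd_mul_left _ _

/-- Every set of the structure agrees below any given bound with a coded set. -/
theorem exists_code {F : Set M.N} (hF : F ∈ M.sets) (c : M.N) :
    ∃ p, ∀ x < c, x ∈ coded p ↔ x ∈ F := by
  obtain ⟨b, hb, hbc⟩ := exists_common_multiple c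
  have hpos (x : M.N) : 0 < 1 + (x + 1) * b := by positivity
  -- The number `a` is the product of the moduli of the elements of `F` below `y`.
  have key : ∀ y : M.N, ∃ a, ∀ x < c, 1 + (x + 1) * b ∣ a ↔ x ∈ F ∧ x < y := by
    refine sigma_induction (φ := .ball (.var 2) (.iff
        (.bex (.succ (.var 1))
          (.eq (.var 2) (.mul (.add .one (.mul (.succ (.var 1)) (.var 5))) (.var 0))))
        (.and (.mem (.var 0) 0) (.lt (.var 0) (.var 2)))))
      (.ball _ (.iff (.bex _ (.eq _ _)) (.and (.mem _ _) (.lt _ _)))) ![⟨F, hF⟩] ![c, b] ?_ ?_ ?_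
    · intro y a
      simp [dvd_iff_exists_le (hpos _)]
    · refine ⟨1, fun x _ => ⟨fun hx => ?_, fun hx => absurd hx.2 not_lt_zero⟩⟩
      obtain ⟨q, -, hq⟩ := (dvd_iff_exists_le (hpos x)).1 hx
      have hq0 : 0 < q := by
        rcases eq_zero_or_pos q with rfl | h
        · simp at hq
        · exact h
      have h1 : 1 + (x + 1) * b ≤ 1 := by
        conv_rhs => rw [hq]
        exact le_mul_of_one_le_right' (Order.one_le_iff_pos.2 hq0)
      have h2 : (1 : M.N) < 1 + (x + 1) * b := lt_add_of_pos_right _ (by positivity)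
      exact absurd (h2.trans_le h1) (lt_irrefl _)
    · rintro y ⟨a, ha⟩
      by_cases hy : y ∈ F ∧ y < c
      · refine ⟨a * (1 + (y + 1) * b), fun x hx => ?_⟩
        rcases eq_or_ne x y with rfl | hne
        · exact ⟨fun _ => ⟨hy.1, lt_succ_iff.2 le_rfl⟩, fun _ => dvd_mul_left _ _⟩
        · have hd : ∃ d, d ∣ b ∧ (y = x + d ∨ x = y + d) := by
            have aux {x y : M.N} (hxy : x < y) (hy : y < c) : ∃ d, d ∣ b ∧ y = x + d := by
              obtain ⟨d, rfl⟩ := exists_add_of_le (Order.add_one_le_iff.2 hxy)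
              exact ⟨d + 1, hbc d ((le_add_self).trans_lt hy), by ring⟩
            rcases hne.lt_or_gt with hxy | hxy
            · obtain ⟨d, hd, e⟩ := aux hxy hy.2
              exact ⟨d, hd, .inl e⟩
            · obtain ⟨d, hd, e⟩ := aux hxy hx
              exact ⟨d, hd, .inr e⟩
          obtain ⟨d, hdb, hd⟩ := hd
          have h1 : 1 + (x + 1) * b ∣ a * (1 + (y + 1) * b) ↔ 1 + (x + 1) * b ∣ a :=
            ⟨modulus_dvd_of_dvd_mul a hdb hd, fun h => h.mul_right _⟩
          rw [h1, ha x hx, lt_succ_iff, le_iff_lt_or_eq]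
          simp [hne]
      · refine ⟨a, fun x hx => ?_⟩
        rw [ha x hx, lt_succ_iff, le_iff_lt_or_eq]
        refine and_congr_right fun hxF => (or_iff_left ?_).symm
        rintro rfl
        exact hy ⟨hxF, hx⟩
  obtain ⟨a, ha⟩ := key c
  refine ⟨pair a b, fun x hx => ?_⟩
  rw [mem_coded, ha x hx]
  exact and_iff_left hx

end Coding

/-! ### Maximal sets for properties of finite character -/

section Greedy

variable {M : Str.{u}} [h : Fact (M.Models RCA0)]

theorem exists_max_of_bounded {F : Set M.N} (hF : F ∈ M.sets) {c : M.N} (hc : ∀ x ∈ F, x < c)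
    (hne : F.Nonempty) : ∃ x ∈ F, ∀ y ∈ F, y ≤ x := by
  have key : ∀ d : M.N, (∀ x < d, x ∉ F) ∨ ∃ x < d, x ∈ F ∧ ∀ y < d, y ∈ F → y < x + 1 := by
    refine bdd_induction (φ := .or (.ball (.var 0) (.neg (.mem (.var 0) 0)))
      (.bex (.var 0) (.and (.mem (.var 0) 0) (.ball (.var 1)
        (.imp (.mem (.var 0) 0) (.lt (.var 0) (.succ (.var 1))))))))
      (.or (.ball _ (.neg (.mem _ _))) (.bex _ (.and (.mem _ _) (.ball _
        (.imp (.mem _ _) (.lt _ _)))))) ![⟨F, hF⟩] ![] ?_ ?_ ?_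
    · intro d
      simp
    · exact .inl fun x hx => absurd hx not_lt_zero
    · intro d hd
      by_cases hdF : d ∈ F
      · exact .inr ⟨d, lt_succ_iff.2 le_rfl, hdF, fun y hy _ => hy⟩
      · have hlt {x : M.N} (hx : x < d + 1) (hxF : x ∈ F) : x < d :=
          (lt_succ_iff.1 hx).lt_of_ne fun e => hdF (e ▸ hxF)
        rcases hd with hd | ⟨x, hx, hxF, hmax⟩
        · exact .inl fun x hx hxF => hd x (hlt hx hxF) hxF
        · exact .inr ⟨x, hx.trans (lt_succ_iff.2 le_rfl), hxF,
            fun y hy hyF => hmax y (hlt hy hyF) hyF⟩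
  rcases key c with hc' | ⟨x, -, hxF, hmax⟩
  · obtain ⟨x, hx⟩ := hne
    exact absurd hx (hc' x (hc x hx))
  · exact ⟨x, hxF, fun y hy => lt_succ_iff.1 (hmax y (hc y hy) hy)⟩

/-- The set with code `p` agrees below `x` with the greedy subset of `A`, where a number `y` is
accepted if `C` contains the code of the set of the earlier choices together with `y`. -/
def IsGreedyBelow (A C : Set M.N) (x p : M.N) : Prop :=
  ∀ y < x, y ∈ coded p ↔ y ∈ A ∧ pair p y ∈ C

theorem IsGreedyBelow.mono {A C : Set M.N} {x y p : M.N} (hp : IsGreedyBelow A C x p)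
    (hyx : y ≤ x) : IsGreedyBelow A C y p :=
  fun z hz => hp z (hz.trans_le hyx)

theorem topCoded_congr {p q y : M.N} (hpq : ∀ z < y, z ∈ coded p ↔ z ∈ coded q) :
    topCoded (pair p y) = topCoded (pair q y) := by
  ext z
  rw [mem_topCoded, mem_topCoded]
  exact or_congr_right (and_congr_right fun hz => hpq z hz)

/-- The bounded formula expressing `IsGreedyBelow A C s t`. -/
def greedyFm {n : ℕ} (s t : Tm n) : Fm 2 n :=
  (Fm.ball (.var 0) (.iff (memCodedTm (.var 0) (.var 2))
    (.and (.mem (.var 0) 0) (.mem (.pair (.var 2) (.var 0)) 1))) : Fm 2 2).subst id ![s, t]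

theorem isBdd_greedyFm {n : ℕ} {s t : Tm n} : IsBdd (greedyFm s t) :=
  IsBdd.subst (.ball _ (.iff isBdd_memCodedTm (.and (.mem _ _) (.mem _ _)))) _ _

@[simp] theorem sat_greedyFm {n : ℕ} {s t : Tm n} {A C : M.sets} {v : Fin n → M.N} :
    (greedyFm s t).Sat M ![A, C] v ↔ IsGreedyBelow A.1 C.1 (s.val M v) (t.val M v) := by
  simp [greedyFm, Fm.sat_subst, vec_val_two, IsGreedyBelow]

/-- `C` decides the codes of sets extensionally. -/
def IsExtensional (C : Set M.N) : Prop :=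
  ∀ w w', topCoded w = topCoded w' → (w ∈ C ↔ w' ∈ C)

/-- By induction, all approximations to the greedy set agree where they are defined. -/
theorem IsGreedyBelow.unique {A C : Set M.N} (hC : IsExtensional C) {x p q : M.N}
    (hp : IsGreedyBelow A C x p) (hq : IsGreedyBelow A C x q) :
    ∀ y < x, y ∈ coded p ↔ y ∈ coded q := by
  have hS : {y | y < x → (y ∈ coded p ↔ y ∈ coded q)} ∈ M.sets :=
    bdd_comprehension (k := 0) (φ := .imp (.lt (.var 0) (.var 1))
      (.iff (memCodedTm (.var 0) (.var 2)) (memCodedTm (.var 0) (.var 3))))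
      (.imp (.lt _ _) (.iff isBdd_memCodedTm isBdd_memCodedTm)) ![] ![x, p, q] (by simp)
  refine fun y => set_strong_induction hS (fun y ih hy => ?_) y
  rw [hp y hy, hq y hy, hC _ _ (topCoded_congr fun z hz => ih z hz (hz.trans hy))]

theorem exists_isGreedyBelow {A C : Set M.N} (hA : A ∈ M.sets) (hC : C ∈ M.sets)
    (hCe : IsExtensional C) (x : M.N) : ∃ p, IsGreedyBelow A C x p := by
  refine sigma_induction (φ := greedyFm (.var 1) (.var 0)) isBdd_greedyFm ![⟨A, hA⟩, ⟨C, hC⟩] ![]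
    (P := IsGreedyBelow A C) ?_ ?_ ?_ x
  · intro x p
    simp
  · exact ⟨0, fun y hy => absurd hy not_lt_zero⟩
  · rintro x ⟨p, hp⟩
    have hF : {y | y < x ∧ y ∈ coded p ∨ y = x ∧ x ∈ A ∧ pair p x ∈ C} ∈ M.sets :=
      bdd_comprehension (φ := .or (.and (.lt (.var 0) (.var 1)) (memCodedTm (.var 0) (.var 2)))
        (.and (.eq (.var 0) (.var 1)) (.and (.mem (.var 1) 0) (.mem (.pair (.var 2) (.var 1)) 1))))
        (.or (.and (.lt _ _) isBdd_memCodedTm) (.and (.eq _ _) (.and (.mem _ _) (.mem _ _))))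
        ![⟨A, hA⟩, ⟨C, hC⟩] ![x, p] (by simp)
    obtain ⟨q, hq⟩ := exists_code hF (x + 1)
    have hpq : ∀ y < x, y ∈ coded p ↔ y ∈ coded q := fun y hy => by
      rw [hq y (hy.trans (lt_succ_iff.2 le_rfl))]
      simp [hy, hy.ne]
    refine ⟨q, fun y hy => ?_⟩
    have hyx := lt_succ_iff.1 hy
    rw [← hCe _ _ (topCoded_congr fun z hz => hpq z (hz.trans_le hyx))]
    rcases hyx.lt_or_eq with hyx | rfl
    · rw [← hpq y hyx, hp y hyx]
    · rw [hq y hy]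
      simp

/-- The greedy subset `B` of a set `A`: whether `x ∈ A` is accepted depends on `C` and on a code `p`
of `B` below `x`. It is `Δ⁰₁` definable, since all approximations to it agree. -/
theorem exists_greedy {A C : Set M.N} (hA : A ∈ M.sets) (hC : C ∈ M.sets)
    (hCe : IsExtensional C) : ∃ B ∈ M.sets, ∀ x, ∃ p,
      (∀ y < x, y ∈ coded p ↔ y ∈ B) ∧ (x ∈ B ↔ x ∈ A ∧ pair p x ∈ C) := by
  have huniq {x y z p q : M.N} (hp : IsGreedyBelow A C (x + 1) p)
      (hq : IsGreedyBelow A C (y + 1) q) (hzx : z < x + 1) (hzy : z < y + 1) :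
      z ∈ coded p ↔ z ∈ coded q := by
    have hz : z < z + 1 := lt_succ_iff.2 le_rfl
    exact (hp.mono (Order.add_one_le_iff.2 hzx)).unique hCe
      (hq.mono (Order.add_one_le_iff.2 hzy)) z hz
  have hlt (x : M.N) : x < x + 1 := lt_succ_iff.2 le_rfl
  refine ⟨{x | ∃ p, IsGreedyBelow A C (x + 1) p ∧ x ∈ coded p}, ?_, fun x => ?_⟩
  · refine delta_comprehension
      (φ := .and (greedyFm (.succ (.var 1)) (.var 0)) (memCodedTm (.var 1) (.var 0)))
      (ψ := .imp (greedyFm (.succ (.var 1)) (.var 0)) (memCodedTm (.var 1) (.var 0)))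
      (.and isBdd_greedyFm isBdd_memCodedTm) (.imp isBdd_greedyFm isBdd_memCodedTm)
      ![⟨A, hA⟩, ⟨C, hC⟩] ![]
      (Q := fun x p => IsGreedyBelow A C (x + 1) p → x ∈ coded p) ?_ ?_ fun x => ⟨?_, ?_⟩
    · simp
    · simp
    · rintro ⟨p, hp, hx⟩ q hq
      exact (huniq hp hq (hlt x) (hlt x)).1 hx
    · intro hx
      obtain ⟨p, hp⟩ := exists_isGreedyBelow hA hC hCe (x + 1)
      exact ⟨p, hp, hx p hp⟩
  · obtain ⟨p, hp⟩ := exists_isGreedyBelow hA hC hCe (x + 1)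
    have hB (y : M.N) (hy : y < x + 1) :
        y ∈ coded p ↔ ∃ p, IsGreedyBelow A C (y + 1) p ∧ y ∈ coded p := by
      constructor
      · exact fun h => ⟨p, hp.mono (Order.add_one_le_iff.2 hy), h⟩
      · rintro ⟨q, hq, h⟩
        exact (huniq hq hp (hlt y) hy).1 h
    exact ⟨p, fun y hy => hB y (hy.trans (hlt x)), (hB x (hlt x)).symm.trans (hp x (hlt x))⟩

/-- The finite character principle for a property `Φ` follows in `RCA₀` once the set of codes of
the finite sets with the property `Φ` exists: the greedy subset is maximal. -/
theorem FiniteCharacter.hasMaximal {Φ : M.sets → Prop} (hΦ : FiniteCharacter M Φ)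
    (hC : {w | Φ ⟨topCoded w, topCoded_mem_sets w⟩} ∈ M.sets) : HasMaximal M Φ := by
  intro A
  have hCe : IsExtensional {w | Φ ⟨topCoded w, topCoded_mem_sets w⟩} := by
    intro w w' hw
    simp only [Set.mem_ofPred_eq, hw]
  obtain ⟨B, hB, hgreedy⟩ := exists_greedy A.2 hC hCe
  have hsub {F G : M.sets} (hG : Φ G) (hFG : F.1 ⊆ G.1) (hF : ∃ b, ∀ x ∈ F.1, M.lt x b) : Φ F :=
    (hΦ.2 G).1 hG F hFG hF
  refine ⟨⟨B, hB⟩, ?_, (hΦ.2 _).2 ?_, ?_⟩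
  · intro x hx
    obtain ⟨p, -, hp⟩ := hgreedy x
    exact (hp.1 hx).1
  · rintro F hFB ⟨c, hc⟩
    rcases F.1.eq_empty_or_nonempty with hF | hF
    · exact hΦ.1 F hF
    · -- `F` is contained in the set of the elements of `B` up to the maximum of `F`.
      obtain ⟨x, hxF, hmax⟩ := exists_max_of_bounded F.2 hc hF
      obtain ⟨p, hp, hx⟩ := hgreedy x
      refine hsub (hx.1 (hFB hxF)).2 (fun y hy => mem_topCoded.2 ?_) ⟨c, hc⟩
      rcases (hmax y hy).lt_or_eq with h | h
      · exact .inr ⟨h, (hp y h).2 (hFB hy)⟩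
      · exact .inl h
  · intro C hBC hCA hΦC x hxC
    obtain ⟨p, hp, hx⟩ := hgreedy x
    refine hx.2 ⟨hCA hxC, hsub hΦC (fun y hy => ?_) ⟨x + 1, fun y hy => ?_⟩⟩
    · rcases mem_topCoded.1 hy with rfl | ⟨h, hy⟩
      · exact hxC
      · exact hBC ((hp y h).1 hy)
    · rcases mem_topCoded.1 hy with rfl | ⟨h, -⟩
      · exact lt_succ_iff.2 le_rfl
      · exact h.trans (lt_succ_iff.2 le_rfl)

end Greedy

/-! ### Replacing set variables by codes -/

/-- Substitution which replaces each free set variable either by a set variable or by a coded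
finite set: an atom `t ∈ X` becomes the bounded formula `t ∈ topCoded c` if the term `c` is
substituted for `X`. -/
def Fm.repl : {k n : ℕ} → Fm k n → {k' n' : ℕ} → (Fin k → Fin k' ⊕ Tm n') → (Fin n → Tm n') →
    Fm k' n'
  | _, _, .eq s t, _, _, _, σ => .eq (s.subst σ) (t.subst σ)
  | _, _, .lt s t, _, _, _, σ => .lt (s.subst σ) (t.subst σ)
  | _, _, .mem t X, _, _, f, σ => (f X).elim (.mem (t.subst σ)) (memTopFm (t.subst σ))
  | _, _, .neg φ, _, _, f, σ => .neg (φ.repl f σ)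
  | _, _, .and φ ψ, _, _, f, σ => .and (φ.repl f σ) (ψ.repl f σ)
  | _, _, .or φ ψ, _, _, f, σ => .or (φ.repl f σ) (ψ.repl f σ)
  | _, _, .allN φ, _, _, f, σ => .allN (φ.repl (fun X => (f X).map id Tm.lift)
      (Fin.cons (.var 0) fun i => (σ i).lift))
  | _, _, .exN φ, _, _, f, σ => .exN (φ.repl (fun X => (f X).map id Tm.lift)
      (Fin.cons (.var 0) fun i => (σ i).lift))
  | _, _, .allS φ, _, _, f, σ =>
      .allS (φ.repl (Fin.cons (.inl 0) fun X => (f X).map Fin.succ id) σ)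
  | _, _, .exS φ, _, _, f, σ =>
      .exS (φ.repl (Fin.cons (.inl 0) fun X => (f X).map Fin.succ id) σ)

section Repl

variable {M : Str.{u}} [h : Fact (M.Models RCA0)]

/-- The set denoted by a set variable or by a code. -/
def denote {k n : ℕ} (V : Fin k → M.sets) (v : Fin n → M.N) : Fin k ⊕ Tm n → M.sets :=
  Sum.elim V fun c => ⟨topCoded (c.val M v), topCoded_mem_sets _⟩

theorem denote_lift {k n : ℕ} (V : Fin k → M.sets) (v : Fin n → M.N) (a : M.N)
    (c : Fin k ⊕ Tm n) : denote V (Fin.cons a v) (c.map id Tm.lift) = denote V v c := by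
  rcases c with X | c <;> simp [denote, Tm.val_lift]

theorem denote_cons {k k' n : ℕ} (V : Fin k' → M.sets) (v : Fin n → M.N) (A : M.sets)
    (f : Fin k → Fin k' ⊕ Tm n) :
    (fun X => denote (Fin.cons A V) v
      ((Fin.cons (.inl 0) fun X => (f X).map Fin.succ id : Fin (k + 1) → Fin (k' + 1) ⊕ Tm n) X)) =
      Fin.cons A fun X => denote V v (f X) := by
  funext X
  refine Fin.cases ?_ (fun X => ?_) X
  · simp [denote]
  · simp only [Fin.cons_succ]
    rcases f X with Y | c <;> simp [denote]

theorem Fm.sat_repl {k n : ℕ} (φ : Fm k n) : ∀ {k' n' : ℕ} (f : Fin k → Fin k' ⊕ Tm n')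
    (σ : Fin n → Tm n') (V : Fin k' → M.sets) (v : Fin n' → M.N),
    (φ.repl f σ).Sat M V v ↔
      φ.Sat M (fun X => denote V v (f X)) fun i => (σ i).val M v := by
  induction φ with
  | eq s t => intros; simp [Fm.repl, Fm.Sat, Tm.val_subst]
  | lt s t => intros; simp [Fm.repl, Fm.Sat, Tm.val_subst]
  | mem t X =>
    intro k' n' f σ V v
    simp only [Fm.repl, Fm.Sat]
    rcases f X with Y | c <;> simp [denote, Tm.val_subst]
  | neg φ ih => intros; simp [Fm.repl, ih]
  | and φ ψ ih ih' => intros; simp [Fm.repl, ih, ih']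
  | or φ ψ ih ih' => intros; simp [Fm.repl, ih, ih']
  | allN φ ih => intros; simp only [Fm.repl, Fm.Sat, ih, Tm.val_lift_cons, denote_lift]
  | exN φ ih => intros; simp only [Fm.repl, Fm.Sat, ih, Tm.val_lift_cons, denote_lift]
  | allS φ ih => intros; simp only [Fm.repl, Fm.Sat, ih, denote_cons]
  | exS φ ih => intros; simp only [Fm.repl, Fm.Sat, ih, denote_cons]

end Repl

/-- A class of formulas is closed under the substitution of set variables and codes for set
variables and of terms for number variables. -/
def ReplClosed (C : FmClass) : Prop :=
  ∀ {k n : ℕ} {φ : Fm k n}, C φ → ∀ {k' n' : ℕ} (f : Fin k → Fin k' ⊕ Tm n') (σ : Fin n → Tm n'),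
    C (φ.repl f σ)

theorem IsBdd.repl : ReplClosed IsBdd := by
  intro k n φ h
  induction h with
  | eq s t => exact fun _ _ => .eq _ _
  | lt s t => exact fun _ _ => .lt _ _
  | mem t X =>
    intro _ _ f σ
    simp only [Fm.repl]
    rcases f X with Y | c
    · exact .mem _ _
    · exact isBdd_memTopFm
  | neg _ ih => exact fun f σ => .neg (ih f σ)
  | and _ _ ih ih' => exact fun f σ => .and (ih f σ) (ih' f σ)
  | or _ _ ih ih' => exact fun f σ => .or (ih f σ) (ih' f σ)
  | ball t _ ih =>
    intro _ _ f σ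
    have := IsBdd.ball (t.subst σ)
      (ih (fun X => (f X).map id Tm.lift) (Fin.cons (.var 0) fun i => (σ i).lift))
    rwa [← Tm.subst_lift] at this
  | bex t _ ih =>
    intro _ _ f σ
    have := IsBdd.bex (t.subst σ)
      (ih (fun X => (f X).map id Tm.lift) (Fin.cons (.var 0) fun i => (σ i).lift))
    rwa [← Tm.subst_lift] at this

theorem IsBdd.isArith {k n : ℕ} {φ : Fm k n} (h : IsBdd φ) : IsArith φ := by
  induction h <;> simp_all [IsArith, Fm.imp]

theorem IsArith.repl : ReplClosed IsArith := by
  intro k n φ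
  induction φ with
  | eq s t => exact fun _ _ _ _ _ => trivial
  | lt s t => exact fun _ _ _ _ _ => trivial
  | mem t X => exact fun _ _ _ f σ => (IsBdd.repl (IsBdd.mem t X) f σ).isArith
  | neg φ ih => exact fun h _ _ f σ => ih h f σ
  | and φ ψ ih ih' => exact fun h _ _ f σ => ⟨ih h.1 f σ, ih' h.2 f σ⟩
  | or φ ψ ih ih' => exact fun h _ _ f σ => ⟨ih h.1 f σ, ih' h.2 f σ⟩
  | allN φ ih => exact fun h _ _ f σ => ih h _ _
  | exN φ ih => exact fun h _ _ f σ => ih h _ _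
  | allS φ ih => exact fun h => h.elim
  | exS φ ih => exact fun h => h.elim

theorem Hier0.repl (s : Side) (m : ℕ) : ReplClosed (Hier0 s m) := by
  intro k n φ h
  induction h with
  | base h => exact fun f σ => .base (h.repl f σ)
  | up _ ih => exact fun f σ => .up (ih f σ)
  | ex _ ih => exact fun f σ => .ex (ih _ _)
  | all _ ih => exact fun f σ => .all (ih _ _)

theorem Hier1Strict.repl (s : Side) (m : ℕ) : ReplClosed (Hier1Strict s m) := by
  intro k n φ h
  induction h with
  | base h => exact fun f σ => .base (IsArith.repl h f σ)
  | up _ ih => exact fun f σ => .up (ih f σ)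
  | ex _ ih => exact fun f σ => .ex (ih _ _)
  | all _ ih => exact fun f σ => .all (ih _ _)

theorem Hier1Closed.repl (s : Side) (m : ℕ) : ReplClosed (Hier1Closed s m) := by
  intro k n φ h
  induction h with
  | strict h => exact fun f σ => .strict (Hier1Strict.repl _ _ h f σ)
  | ex _ ih => exact fun f σ => .ex (ih _ _)
  | all _ ih => exact fun f σ => .all (ih _ _)

theorem Hier1.repl (r : Reading) (s : Side) (m : ℕ) : ReplClosed (Hier1 r s m) := by
  cases r
  · exact Hier1Strict.repl s m
  · exact Hier1Closed.repl s m

/-! ### Comprehension proves the finite character principle -/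

section Comprehension

variable {M : Str.{u}} [h : Fact (M.Models RCA0)]

/-- The formula `φ(topCoded w)`, where `w` is the new number variable of index `0`. -/
def Fm.atCode {k n : ℕ} (φ : Fm (k + 1) n) : Fm k (n + 1) :=
  φ.repl (Fin.cons (.inr (.var 0)) .inl) fun i => .var i.succ

theorem Fm.sat_atCode {k n : ℕ} {φ : Fm (k + 1) n} {V : Fin k → M.sets} {v : Fin n → M.N}
    {w : M.N} : φ.atCode.Sat M V (Fin.cons w v) ↔
      φ.Sat M (Fin.cons ⟨topCoded w, topCoded_mem_sets w⟩ V) v := by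
  have : (fun X => denote V (Fin.cons w v : Fin (n + 1) → M.N)
      ((Fin.cons (.inr (.var 0)) .inl : Fin (k + 1) → Fin k ⊕ Tm (n + 1)) X)) =
      Fin.cons ⟨topCoded w, topCoded_mem_sets w⟩ V := by
    funext X
    refine Fin.cases ?_ (fun X => ?_) X <;> simp [denote]
  rw [Fm.atCode, Fm.sat_repl, this]
  simp

theorem models_fcp_of_ca {C : FmClass} (hC : ReplClosed C) (hM : M.Models (ca C)) :
    M.Models (fcp C) := by
  refine models_fcp.2 fun φ hφ V v hfin => hfin.hasMaximal ?_
  have := models_ca.1 hM φ.atCode (hC hφ _ _) V v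
  simpa only [Fm.sat_atCode] using this

theorem models_fcpDelta_of_caDelta {S P : FmClass} (hS : ReplClosed S) (hP : ReplClosed P)
    (hM : M.Models (caDelta S P)) : M.Models (fcpDelta S P) := by
  refine models_fcpDelta.2 fun φ ψ hφ hψ V v hfin hiff => hfin.hasMaximal ?_
  have := models_caDelta.1 hM φ.atCode ψ.atCode (hS hφ _ _) (hP hψ _ _) V v
    fun w => by rw [Fm.sat_atCode, Fm.sat_atCode]; exact hiff _
  simpa only [Fm.sat_atCode] using this

theorem models_FCP_of_models_CA {Γ : Gam} (hM : M.Models (CA Γ)) : M.Models (FCP Γ) := by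
  cases Γ with
  | sigma0 m => exact models_fcp_of_ca (Hier0.repl _ _) hM
  | pi0 m => exact models_fcp_of_ca (Hier0.repl _ _) hM
  | delta0 m => exact models_fcpDelta_of_caDelta (Hier0.repl _ _) (Hier0.repl _ _) hM
  | sigma1 r m => exact models_fcp_of_ca (Hier1.repl _ _ _) hM
  | pi1 r m => exact models_fcp_of_ca (Hier1.repl _ _ _) hM
  | delta1 r m => exact models_fcpDelta_of_caDelta (Hier1.repl _ _ _) (Hier1.repl _ _ _) hM

end Comprehension

/-! ### Inclusions between the classes of formulas -/

theorem IsArith.imp {k n : ℕ} {φ ψ : Fm k n} (hφ : IsArith φ) (hψ : IsArith ψ) :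
    IsArith (φ.imp ψ) := by
  simp [Fm.imp, IsArith, hφ, hψ]

theorem IsArith.hier1Strict {k n : ℕ} {φ : Fm k n} (hφ : IsArith φ) (m : ℕ) :
    ∀ s, Hier1Strict s m φ := by
  induction m with
  | zero => exact fun s => .base hφ
  | succ m ih => exact fun s => .up (ih _)

theorem IsBdd.hier0 {k n : ℕ} {φ : Fm k n} (hφ : IsBdd φ) (m : ℕ) : ∀ s, Hier0 s m φ := by
  induction m with
  | zero => exact fun s => .base hφ
  | succ m ih => exact fun s => .up (ih _)

/-- `Π⁰₁ ⊆ Π⁰ₘ` for `m ≥ 1`. -/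
theorem Hier0.pi_one_le {m k n : ℕ} {φ : Fm k n} (hφ : Hier0 .pi 1 φ) : Hier0 .pi (m + 1) φ := by
  generalize hs : Side.pi = s at hφ
  generalize hl : 1 = l at hφ
  induction hφ with
  | base h => exact absurd hl one_ne_zero
  | @up s l _ _ _ h =>
    obtain rfl : l = 0 := by omega
    generalize s.dual = s' at h
    cases h with
    | base h => exact h.hier0 _ _
  | ex _ ih => cases hs
  | all _ ih => exact .all (ih hs hl)

theorem Hier0.isArith {s : Side} {m k n : ℕ} {φ : Fm k n} (hφ : Hier0 s m φ) : IsArith φ := by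
  induction hφ with
  | base h => exact h.isArith
  | up _ ih => exact ih
  | ex _ ih => exact ih
  | all _ ih => exact ih

theorem IsQF.isBdd {k n : ℕ} {φ : Fm k n} (hφ : IsQF φ) : IsBdd φ := by
  induction φ with
  | eq s t => exact .eq _ _
  | lt s t => exact .lt _ _
  | mem t X => exact .mem _ _
  | neg φ ih => exact .neg (ih hφ)
  | and φ ψ ih ih' => exact .and (ih hφ.1) (ih' hφ.2)
  | or φ ψ ih ih' => exact .or (ih hφ.1) (ih' hφ.2)
  | allN φ ih => exact hφ.elim
  | exN φ ih => exact hφ.elim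
  | allS φ ih => exact hφ.elim
  | exS φ ih => exact hφ.elim

/-! ### The finite character principle proves comprehension -/

/-- In the structure `M`, the class `C` is closed, up to equivalence, under universal number
quantification relativized to a bounded formula. -/
def GuardedAll (M : Str.{u}) (C : FmClass) : Prop :=
  ∀ {k n : ℕ} {χ φ : Fm k (n + 1)}, IsBdd χ → C φ → ∃ φ' : Fm k n, C φ' ∧ ∀ V v,
    φ'.Sat M V v ↔ ∀ x, χ.Sat M V (Fin.cons x v) → φ.Sat M V (Fin.cons x v)

section Reversal

variable {M : Str.{u}} [h : Fact (M.Models RCA0)]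

theorem finiteCharacter_forall_mem (P : M.N → Prop) :
    FiniteCharacter M fun A => ∀ x ∈ A.1, P x := by
  refine ⟨fun A hA x hx => ?_, fun A => ⟨fun hA F hF _ x hx => hA x (hF hx), fun hA x hx => ?_⟩⟩
  · simp [hA] at hx
  · refine hA ⟨{x}, singleton_mem_sets x⟩ (by simpa using hx) ⟨x + 1, ?_⟩ x rfl
    rintro y rfl
    exact lt_succ_iff.2 le_rfl

theorem HasMaximal.mem_sets {P : M.N → Prop} (hP : HasMaximal M fun A => ∀ x ∈ A.1, P x) :
    {x | P x} ∈ M.sets := by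
  obtain ⟨B, -, hB, hmax⟩ := hP ⟨_, univ_mem_sets⟩
  convert B.2
  ext x
  refine ⟨fun hx => ?_, hB x⟩
  have hC : {y | y ∈ B.1 ∨ y = x} ∈ M.sets :=
    bdd_comprehension (φ := .or (.mem (.var 0) 0) (.eq (.var 0) (.var 1)))
      (.or (.mem _ _) (.eq _ _)) ![B] ![x] (by simp)
  refine hmax ⟨_, hC⟩ (fun y hy => .inl hy) (Set.subset_univ _) ?_ (.inr rfl)
  rintro y (hy | rfl)
  · exact hB y hy
  · exact hx

/-- The formula `∀ x ∈ X, θ(x)` in the class `C`, where `X` is the new set variable of index `0`. -/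
theorem GuardedAll.exists_forall_mem {C : FmClass} (hR : ReplClosed C) (hG : GuardedAll M C)
    {k n : ℕ} {θ : Fm k (n + 1)} (hθ : C θ) : ∃ φ : Fm (k + 1) n, C φ ∧ ∀ A V v,
      φ.Sat M (Fin.cons A V) v ↔ ∀ x ∈ A.1, θ.Sat M V (Fin.cons x v) := by
  obtain ⟨φ, hφ, h⟩ := hG (χ := .mem (.var 0) 0) (.mem _ _) (hR hθ (fun X => .inl X.succ) .var)
  refine ⟨φ, hφ, fun A V v => ?_⟩
  simp [h, Fm.sat_repl, denote]

theorem models_ca_of_fcp {C : FmClass} (hR : ReplClosed C) (hG : GuardedAll M C)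
    (hM : M.Models (fcp C)) : M.Models (ca C) := by
  refine models_ca.2 fun θ hθ V v => ?_
  obtain ⟨φ, hφ, h⟩ := hG.exists_forall_mem hR hθ
  have := models_fcp.1 hM φ hφ V v
  simp only [h] at this
  exact (this (finiteCharacter_forall_mem _)).mem_sets

theorem models_caDelta_of_fcpDelta {S P : FmClass} (hRS : ReplClosed S) (hRP : ReplClosed P)
    (hGS : GuardedAll M S) (hGP : GuardedAll M P) (hM : M.Models (fcpDelta S P)) :
    M.Models (caDelta S P) := by
  refine models_caDelta.2 fun θ η hθ hη V v hiff => ?_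
  obtain ⟨φ, hφ, h⟩ := hGS.exists_forall_mem hRS hθ
  obtain ⟨ψ, hψ, h'⟩ := hGP.exists_forall_mem hRP hη
  have := models_fcpDelta.1 hM φ ψ hφ hψ V v
  simp only [h, h', hiff, implies_true, forall_const] at this
  simp only [hiff]
  exact (this (finiteCharacter_forall_mem _)).mem_sets

end Reversal

/-! ### Closure properties of the classes of formulas -/

theorem exists_imp_iff_imp_exists {α : Type*} [Nonempty α] {a : Prop} {p : α → Prop} :
    (∃ x, a → p x) ↔ (a → ∃ x, p x) := by
  by_cases ha : a <;> simp [ha]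

/-- A bounded premise can be moved into the matrix, since the quantifiers range over nonempty
domains. -/
theorem Hier1Strict.guard {M : Str.{u}} {s : Side} {m k n : ℕ} {φ : Fm k n}
    (hφ : Hier1Strict s m φ) :
    ∀ {χ : Fm k n}, IsBdd χ → ∃ φ' : Fm k n, Hier1Strict s m φ' ∧ ∀ V v,
      φ'.Sat M V v ↔ (χ.Sat M V v → φ.Sat M V v) := by
  induction hφ with
  | base hφ => exact fun hχ => ⟨_, .base (hχ.isArith.imp hφ), fun V v => sat_imp⟩
  | up _ ih =>
    intro χ hχ
    obtain ⟨φ', h, h'⟩ := ih hχ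
    exact ⟨φ', .up h, h'⟩
  | ex _ ih =>
    intro χ hχ
    obtain ⟨φ', h, h'⟩ := ih (hχ.subst Fin.succ .var)
    have : Nonempty M.sets := M.sets_nonempty.to_subtype
    refine ⟨_, .ex h, fun V v => ?_⟩
    simp only [Fm.Sat, h', sat_weaken, exists_imp_iff_imp_exists]
  | all _ ih =>
    intro χ hχ
    obtain ⟨φ', h, h'⟩ := ih (hχ.subst Fin.succ .var)
    refine ⟨_, .all h, fun V v => ?_⟩
    simp only [Fm.Sat, h', sat_weaken]
    exact forall_comm

/-- The negation of a strict formula is equivalent to a strict formula of the other side. -/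
theorem Hier1Strict.dual {M : Str.{u}} {s : Side} {m k n : ℕ} {φ : Fm k n}
    (hφ : Hier1Strict s m φ) :
    ∃ φ' : Fm k n, Hier1Strict s.dual m φ' ∧ ∀ V v, φ'.Sat M V v ↔ ¬ φ.Sat M V v := by
  induction hφ with
  | @base _ _ _ φ hφ => exact ⟨.neg φ, .base (by simpa [IsArith] using hφ), fun V v => Iff.rfl⟩
  | up _ ih =>
    obtain ⟨φ', h, h'⟩ := ih
    exact ⟨φ', .up h, h'⟩
  | ex _ ih =>
    obtain ⟨φ', h, h'⟩ := ih
    exact ⟨_, .all h, fun V v => by simp only [Fm.Sat, h', not_exists]⟩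
  | all _ ih =>
    obtain ⟨φ', h, h'⟩ := ih
    exact ⟨_, .ex h, fun V v => by simp only [Fm.Sat, h', not_forall]⟩

theorem guardedAll_true {M : Str.{u}} : GuardedAll M fun _ => True :=
  fun {_ _ χ φ} _ _ => ⟨.allN (χ.imp φ), trivial, fun _ _ => forall_congr' fun _ => sat_imp⟩

section Closure

variable {M : Str.{u}} [h : Fact (M.Models RCA0)]

theorem Hier0.guard {s : Side} {m k n : ℕ} {φ : Fm k n} (hφ : Hier0 s m φ) :
    ∀ {χ : Fm k n}, IsBdd χ → ∃ φ' : Fm k n, Hier0 s m φ' ∧ ∀ V v,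
      φ'.Sat M V v ↔ (χ.Sat M V v → φ.Sat M V v) := by
  induction hφ with
  | base hφ => exact fun hχ => ⟨_, .base (hχ.imp hφ), fun V v => sat_imp⟩
  | up _ ih =>
    intro χ hχ
    obtain ⟨φ', h, h'⟩ := ih hχ
    exact ⟨φ', .up h, h'⟩
  | ex _ ih =>
    intro χ hχ
    obtain ⟨φ', h, h'⟩ := ih (hχ.subst id fun i => .var i.succ)
    have : Nonempty M.N := ⟨0⟩
    refine ⟨_, .ex h, fun V v => ?_⟩
    simp only [Fm.Sat, h', sat_weakenN, exists_imp_iff_imp_exists]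
  | all _ ih =>
    intro χ hχ
    obtain ⟨φ', h, h'⟩ := ih (hχ.subst id fun i => .var i.succ)
    refine ⟨_, .all h, fun V v => ?_⟩
    simp only [Fm.Sat, h', sat_weakenN]
    exact forall_comm

theorem Hier0.guardedAll (m : ℕ) : GuardedAll M (Hier0 .pi (m + 1)) := by
  intro k n χ φ hχ hφ
  obtain ⟨φ', h, h'⟩ := hφ.guard (M := M) hχ
  exact ⟨.allN φ', .all h, fun V v => forall_congr' fun x => h' V _⟩

/-- A number quantifier relativized to a singleton `X` commutes with set quantifiers, so that it can
be moved into the arithmetical matrix. If `X` is not a singleton, both sides are vacuously true. -/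
theorem Hier1Strict.exists_forall_singleton {s : Side} {m k n : ℕ} {φ : Fm k n}
    (hφ : Hier1Strict s m φ) : ∀ {l : ℕ} (σ : Fin n → Tm (l + 1)) (X : Fin k),
      ∃ φ' : Fm k l, Hier1Strict s m φ' ∧ ∀ V v, φ'.Sat M V v ↔
        ∀ x, (V X).1 = {x} → φ.Sat M V fun i => (σ i).val M (Fin.cons x v) := by
  induction hφ with
  | @base _ _ _ ψ hφ =>
    intro l σ X
    refine ⟨.allN (.imp (.allN (.iff (.mem (.var 0) X) (.eq (.var 0) (.var 1))))
      (ψ.repl .inl σ)), .base ?_, fun V v => ?_⟩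
    · simpa [IsArith, Fm.iff, Fm.imp] using IsArith.repl hφ .inl σ
    · simp only [Fm.Sat, sat_imp, sat_iff, Fm.sat_repl, denote, Sum.elim_inl, Set.ext_iff,
        Set.mem_singleton_iff]
      rfl
  | up _ ih =>
    intro l σ X
    obtain ⟨φ', h, h'⟩ := ih σ X
    exact ⟨φ', .up h, h'⟩
  | ex _ ih =>
    intro l σ X
    obtain ⟨φ', h, h'⟩ := ih σ X.succ
    refine ⟨_, .ex h, fun V v => ?_⟩
    simp only [Fm.Sat, h', Fin.cons_succ]
    by_cases hX : ∃ a, (V X).1 = {a}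
    · obtain ⟨a, ha⟩ := hX
      simp [ha]
    · have := M.sets_nonempty.to_subtype
      push Not at hX
      simp [hX]
  | all _ ih =>
    intro l σ X
    obtain ⟨φ', h, h'⟩ := ih σ X.succ
    refine ⟨_, .all h, fun V v => ?_⟩
    simp only [Fm.Sat, h', Fin.cons_succ]
    exact ⟨fun H x hx A => H A x hx, fun H A x hx => H x hx A⟩

/-- Strict `Π¹ₘ` is closed under universal number quantification for `m ≥ 1`: the quantifier
`∀ x` is replaced by a quantifier over the singletons `{x}`. -/
theorem Hier1Strict.guardedAll (m : ℕ) : GuardedAll M (Hier1Strict .pi (m + 1)) := by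
  intro k n χ φ hχ hφ
  obtain ⟨φ₁, h₁, h₁'⟩ := hφ.guard (M := M) hχ
  obtain ⟨φ₂, h₂, h₂'⟩ := (Hier1Strict.repl _ _ h₁ (fun X => .inl X.succ)
    .var).exists_forall_singleton (M := M) .var 0
  refine ⟨_, .all h₂, fun V v => ?_⟩
  simp only [Fm.Sat, h₂', Fm.sat_repl, denote, val_var, Sum.elim_inl, Fin.cons_zero, Fin.cons_succ,
    h₁']
  exact ⟨fun H x => H ⟨{x}, singleton_mem_sets x⟩ x rfl, fun H A x _ => H x⟩

theorem Hier1Closed.guard {s : Side} {m k n : ℕ} {φ : Fm k n} (hφ : Hier1Closed s m φ) :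
    ∀ {χ : Fm k n}, IsBdd χ → ∃ φ' : Fm k n, Hier1Closed s m φ' ∧ ∀ V v,
      φ'.Sat M V v ↔ (χ.Sat M V v → φ.Sat M V v) := by
  induction hφ with
  | strict hφ =>
    intro χ hχ
    obtain ⟨φ', h, h'⟩ := hφ.guard (M := M) hχ
    exact ⟨φ', .strict h, h'⟩
  | ex _ ih =>
    intro χ hχ
    obtain ⟨φ', h, h'⟩ := ih (hχ.subst id fun i => .var i.succ)
    have : Nonempty M.N := ⟨0⟩
    refine ⟨_, .ex h, fun V v => ?_⟩
    simp only [Fm.Sat, h', sat_weakenN, exists_imp_iff_imp_exists]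
  | all _ ih =>
    intro χ hχ
    obtain ⟨φ', h, h'⟩ := ih (hχ.subst id fun i => .var i.succ)
    refine ⟨_, .all h, fun V v => ?_⟩
    simp only [Fm.Sat, h', sat_weakenN]
    exact forall_comm

theorem Hier1Closed.guardedAll (s : Side) (m : ℕ) : GuardedAll M (Hier1Closed s m) := by
  intro k n χ φ hχ hφ
  obtain ⟨φ', h, h'⟩ := hφ.guard (M := M) hχ
  exact ⟨.allN φ', .all h, fun V v => forall_congr' fun x => h' V _⟩

end Closure

/-! ### Relations represented by sets of codes of tuples -/

section Representation

variable {M : Str.{u}} [h : Fact (M.Models RCA0)]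

/-- The code of a tuple, by iterated pairing. -/
def enc : {n : ℕ} → (Fin n → M.N) → M.N
  | 0, _ => 0
  | _ + 1, v => pair (v 0) (enc fun i => v i.succ)

theorem enc_injective : ∀ {n : ℕ}, Function.Injective (enc : (Fin n → M.N) → M.N)
  | 0 => fun _ _ _ => Subsingleton.elim _ _
  | n + 1 => fun v w hvw => by
    obtain ⟨h0, h1⟩ := pair_inj.1 hvw
    funext i
    exact Fin.cases h0 (fun i => congrFun (enc_injective h1) i) i

theorem enc_cons {n : ℕ} (x : M.N) (v : Fin n → M.N) : enc (Fin.cons x v) = pair x (enc v) := by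
  simp [enc]

/-- The term for the code of a tuple. -/
def encTm {m : ℕ} : {n : ℕ} → (Fin n → Tm m) → Tm m
  | 0, _ => .zero
  | _ + 1, σ => .pair (σ 0) (encTm fun i => σ i.succ)

theorem val_encTm {m : ℕ} (v : Fin m → M.N) : ∀ {n : ℕ} (σ : Fin n → Tm m),
    (encTm σ).val M v = enc fun i => (σ i).val M v
  | 0, _ => rfl
  | n + 1, σ => by simp [encTm, enc, val_encTm v]

/-- A relation is represented if the codes of its tuples are the codes of tuples in some set of the
structure. -/
def Represented {n : ℕ} (R : (Fin n → M.N) → Prop) : Prop := ∃ S ∈ M.sets, ∀ v, R v ↔ enc v ∈ S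

theorem Represented.mem_sets {n : ℕ} {R : (Fin (n + 1) → M.N) → Prop} (hR : Represented R)
    (v : Fin n → M.N) : {x | R (Fin.cons x v)} ∈ M.sets := by
  obtain ⟨S, hS, h⟩ := hR
  simp only [h, enc_cons]
  exact bdd_comprehension (φ := .mem (.pair (.var 0) (.var 1)) 0) (.mem _ _) ![⟨S, hS⟩] ![enc v]
    (by simp)

theorem Represented.not {n : ℕ} {R : (Fin n → M.N) → Prop} (hR : Represented R) :
    Represented fun v => ¬ R v := by
  obtain ⟨S, hS, h⟩ := hR
  exact ⟨Sᶜ, compl_mem_sets hS, fun v => not_congr (h v)⟩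

theorem Represented.and {n : ℕ} {R Q : (Fin n → M.N) → Prop} (hR : Represented R)
    (hQ : Represented Q) : Represented fun v => R v ∧ Q v := by
  obtain ⟨S, hS, h⟩ := hR
  obtain ⟨T, hT, h'⟩ := hQ
  exact ⟨S ∩ T, inter_mem_sets hS hT, fun v => and_congr (h v) (h' v)⟩

theorem Represented.or {n : ℕ} {R Q : (Fin n → M.N) → Prop} (hR : Represented R)
    (hQ : Represented Q) : Represented fun v => R v ∨ Q v := by
  simpa only [not_and_or, not_not] using (hR.not.and hQ.not).not

theorem Represented.all (hM : M.Models (ca (Hier0 .pi 1))) {n : ℕ} {R : (Fin (n + 1) → M.N) → Prop}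
    (hR : Represented R) : Represented fun v => ∀ x, R (Fin.cons x v) := by
  obtain ⟨S, hS, h⟩ := hR
  refine ⟨{p | ∀ x, pair x p ∈ S}, ?_, fun v => by simp only [h, enc_cons]; rfl⟩
  exact models_ca.1 hM (.allN (.mem (.pair (.var 0) (.var 1)) 0)) (.all (.up (.base (.mem _ _))))
    ![⟨S, hS⟩] ![]

theorem Represented.ex (hM : M.Models (ca (Hier0 .pi 1))) {n : ℕ} {R : (Fin (n + 1) → M.N) → Prop}
    (hR : Represented R) : Represented fun v => ∃ x, R (Fin.cons x v) := by
  simpa only [not_forall, not_not] using (hR.not.all hM).not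

/-- Universal quantification over all number variables but the last one. -/
theorem GuardedAll.exists_forall_snoc {C : FmClass} (hG : GuardedAll M C) {k : ℕ} :
    ∀ {n : ℕ} {φ : Fm k (n + 1)}, C φ → ∃ φ' : Fm k 1, C φ' ∧ ∀ V p,
      φ'.Sat M V ![p] ↔ ∀ v : Fin n → M.N, φ.Sat M V (Fin.snoc v p)
  | 0, φ, hφ => by
    refine ⟨φ, hφ, fun V p => ?_⟩
    have (v : Fin 0 → M.N) : (Fin.snoc v p : Fin 1 → M.N) = ![p] := by
      funext i
      fin_cases i
      rfl
    simp [this]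
  | n + 1, φ, hφ => by
    obtain ⟨φ₁, h₁, h₁'⟩ := hG (χ := .eq .zero .zero) (.eq _ _) hφ
    obtain ⟨φ₂, h₂, h₂'⟩ := hG.exists_forall_snoc h₁
    refine ⟨φ₂, h₂, fun V p => ?_⟩
    simp only [h₂', h₁', sat_eq, forall_const, Fin.cons_snoc_eq_snoc_cons]
    exact ⟨fun H v => by simpa using H (Fin.tail v) (v 0), fun H v x => H _⟩

/-- Comprehension for `C` represents the relations defined by formulas `φ(v)` in `C`, by the set of
all `p` with `∀ v (enc v = p → φ(v))`. -/
theorem represented_of_models_ca {C : FmClass} (hR : ReplClosed C) (hG : GuardedAll M C)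
    (hM : M.Models (ca C)) {k n : ℕ} {φ : Fm k n} (hφ : C φ) (V : Fin k → M.sets) :
    Represented fun v => φ.Sat M V v := by
  obtain ⟨φ₁, h₁, h₁'⟩ := hG (χ := .eq (encTm fun i : Fin n => .var i.castSucc.succ)
    (.var (Fin.last n).succ)) (.eq _ _) (hR hφ .inl fun i => .var i.castSucc.succ)
  obtain ⟨φ₂, h₂, h₂'⟩ := hG.exists_forall_snoc h₁
  refine ⟨{p | φ₂.Sat M V ![p]}, models_ca.1 hM φ₂ h₂ V ![], fun v => ?_⟩
  have : Nonempty M.N := ⟨0⟩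
  simp only [Set.mem_ofPred_eq, h₂', h₁', sat_eq, val_encTm, val_var, Fin.cons_succ,
    Fin.snoc_castSucc, Fin.snoc_last, Fm.sat_repl, denote, Sum.elim_inl, forall_const,
    enc_injective.eq_iff]
  exact ⟨fun H w hw => hw ▸ H, fun H => H v rfl⟩

theorem represented_of_isArith (hM : M.Models (ca (Hier0 .pi 1))) {k n : ℕ} {φ : Fm k n}
    (hφ : IsArith φ) (V : Fin k → M.sets) : Represented fun v => φ.Sat M V v := by
  have atom {n : ℕ} {φ : Fm k n} (hφ : IsBdd φ) : Represented fun v => φ.Sat M V v :=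
    represented_of_models_ca (Hier0.repl _ _) (Hier0.guardedAll 0) hM (hφ.hier0 1 .pi) V
  induction φ with
  | eq s t => exact atom (.eq _ _)
  | lt s t => exact atom (.lt _ _)
  | mem t X => exact atom (.mem _ _)
  | neg φ ih => exact (ih hφ V atom).not
  | and φ ψ ih ih' => exact (ih hφ.1 V atom).and (ih' hφ.2 V atom)
  | or φ ψ ih ih' => exact (ih hφ.1 V atom).or (ih' hφ.2 V atom)
  | allN φ ih => exact (ih hφ V atom).all hM
  | exN φ ih => exact (ih hφ V atom).ex hM
  | allS φ ih => exact hφ.elim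
  | exS φ ih => exact hφ.elim

/-- `Π⁰₁` comprehension proves arithmetical comprehension. -/
theorem models_ca_isArith (hM : M.Models (ca (Hier0 .pi 1))) : M.Models (ca IsArith) :=
  models_ca.2 fun _ hφ V v => (represented_of_isArith hM hφ V).mem_sets v

theorem represented_of_hier1Closed {m : ℕ} (hM : M.Models (ca (Hier1Strict .pi (m + 1)))) {s : Side}
    {k n : ℕ} {φ : Fm k n} (hφ : Hier1Closed s (m + 1) φ) (V : Fin k → M.sets) :
    Represented fun v => φ.Sat M V v := by
  have hpi {n : ℕ} {φ : Fm k n} (hφ : Hier1Strict .pi (m + 1) φ) :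
      Represented fun v => φ.Sat M V v :=
    represented_of_models_ca (Hier1Strict.repl _ _) (Hier1Strict.guardedAll m) hM hφ V
  have hM0 : M.Models (ca (Hier0 .pi 1)) := models_ca_mono hM fun h => h.isArith.hier1Strict _ _
  generalize hl : m + 1 = l at hφ
  induction hφ with
  | strict hφ =>
    subst hl
    cases s with
    | pi => exact hpi hφ
    | sigma =>
      obtain ⟨φ', h, h'⟩ := hφ.dual (M := M)
      simpa only [h', not_not] using (hpi h).not
  | ex _ ih => exact ih.ex hM0
  | all _ ih => exact ih.all hM0

/-- Strict `Π¹ₘ` comprehension proves comprehension for `Σ¹ₘ` and `Π¹ₘ` formulas in the sense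
which allows a prefix of number quantifiers. -/
theorem models_ca_hier1Closed {m : ℕ} (hM : M.Models (ca (Hier1Strict .pi (m + 1)))) (s : Side) :
    M.Models (ca (Hier1Closed s (m + 1))) :=
  models_ca.2 fun _ hφ V v => (represented_of_hier1Closed hM hφ V).mem_sets v

theorem models_ca_strict_pi_of_sigma {m : ℕ} (hM : M.Models (ca (Hier1Closed .sigma m))) :
    M.Models (ca (Hier1Strict .pi m)) := by
  refine models_ca.2 fun φ hφ V v => ?_
  obtain ⟨φ', h, h'⟩ := hφ.dual (M := M)
  have := compl_mem_sets (models_ca.1 hM φ' (.strict h) V v)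
  simpa only [h', Set.compl_ofPred, not_not] using this

end Representation

end SOA

open SOA
theorem mainTheorem9 :
    -- Part (1)
    (∀ m : ℕ, 1 ≤ m → ∀ r : Reading,
      ∀ Γ ∈ ({.pi0 m, .sigma0 m, .delta0 m, .pi1 r m, .sigma1 r m, .delta1 r m} : Set Gam),
        Proves.{u} (CA0 Γ) (FCP Γ)) ∧
    -- Part (2)
    (∀ m : ℕ, 1 ≤ m →
      ∀ Γ ∈ ({.pi0 m, .pi1 .strict m, .pi1 .closed m, .sigma1 .closed m, .delta1 .closed m} :
          Set Gam),
        Proves.{u} (RCA0 ∪ FCP Γ) (CA0 Γ)) ∧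
    -- Corollary
    (Proves.{u} RCA0 (FCP (.delta0 1)) ∧ Proves.{u} RCA0 (FCP (.sigma0 0)) ∧
      Proves.{u} RCA0 FCPQF) ∧
    (∀ m : ℕ, 1 ≤ m → EquivOver.{u} RCA0 ACA0 (FCP (.pi0 m))) ∧
    (∀ m : ℕ, 1 ≤ m → EquivOver.{u} RCA0 (CA0 (.delta1 .closed m)) (FCP (.delta1 .closed m))) ∧
    (∀ m : ℕ, 1 ≤ m → ∀ r : Reading,
      EquivOver.{u} RCA0 (CA0 (.pi1 r m)) (FCP (.pi1 .strict m)) ∧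
      EquivOver.{u} RCA0 (CA0 (.pi1 r m)) (FCP (.pi1 .closed m)) ∧
      EquivOver.{u} RCA0 (CA0 (.pi1 r m)) (FCP (.sigma1 .closed m))) ∧
    EquivOver.{u} RCA0 Z2 FCPFull := by
  have forward (Γ : Gam) (M : Str.{u}) (hR : M.Models RCA0) (hM : M.Models (CA Γ)) :
      M.Models (FCP Γ) :=
    have := Fact.mk hR
    models_FCP_of_models_CA hM
  have reversal (m : ℕ) (hm : 1 ≤ m) (Γ : Gam) (hΓ : Γ ∈ ({.pi0 m, .pi1 .strict m,
      .pi1 .closed m, .sigma1 .closed m, .delta1 .closed m} : Set Gam)) (M : Str.{u})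
      (hR : M.Models RCA0) (hM : M.Models (FCP Γ)) : M.Models (CA Γ) := by
    have := Fact.mk hR
    obtain ⟨l, rfl⟩ := Nat.exists_eq_add_of_le' hm
    rcases hΓ with rfl | rfl | rfl | rfl | rfl
    · exact models_ca_of_fcp (Hier0.repl _ _) (Hier0.guardedAll l) hM
    · exact models_ca_of_fcp (Hier1Strict.repl _ _) (Hier1Strict.guardedAll l) hM
    · exact models_ca_of_fcp (Hier1Closed.repl _ _) (Hier1Closed.guardedAll _ _) hM
    · exact models_ca_of_fcp (Hier1Closed.repl _ _) (Hier1Closed.guardedAll _ _) hM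
    · exact models_caDelta_of_fcpDelta (Hier1Closed.repl _ _) (Hier1Closed.repl _ _)
        (Hier1Closed.guardedAll _ _) (Hier1Closed.guardedAll _ _) hM
  -- A bounded formula is both `Σ⁰₁` and `Π⁰₁`.
  have sigma00 (M : Str.{u}) (hR : M.Models RCA0) {k n : ℕ} {φ : Fm (k + 1) n} (hφ : IsBdd φ) :=
    models_fcpDelta.1 (forward (.delta0 1) M hR (models_RCA0.1 hR).2.2) φ φ (hφ.hier0 1 _)
      (hφ.hier0 1 _)
  -- Strict `Π¹ₘ` comprehension is equivalent to comprehension for either reading of `Π¹ₘ`.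
  have toStrict (m : ℕ) (r : Reading) (M : Str.{u}) (hM : M.Models (CA (.pi1 r m))) :
      M.Models (CA (.pi1 .strict m)) := by
    cases r with
    | strict => exact hM
    | closed => exact models_ca_mono hM .strict
  have ofStrict (m : ℕ) (hm : 1 ≤ m) (s : Side) (M : Str.{u}) (hR : M.Models RCA0)
      (hM : M.Models (CA (.pi1 .strict m))) : M.Models (ca (Hier1Closed s m)) := by
    have := Fact.mk hR
    obtain ⟨l, rfl⟩ := Nat.exists_eq_add_of_le' hm
    exact models_ca_hier1Closed hM s
  have toReading (m : ℕ) (hm : 1 ≤ m) (r : Reading) (M : Str.{u}) (hR : M.Models RCA0)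
      (hM : M.Models (CA (.pi1 .strict m))) : M.Models (CA (.pi1 r m)) := by
    cases r with
    | strict => exact hM
    | closed => exact ofStrict m hm .pi M hR hM
  simp only [EquivOver, Proves, CA0, ACA0, models_union]
  refine ⟨?_, ?_, ⟨?_, ?_, ?_⟩, ?_, ?_, ?_, ?_, ?_⟩
  · exact fun m _ r Γ _ M hM => forward Γ M hM.1 hM.2
  · exact fun m hm Γ hΓ M hM => ⟨hM.1, reversal m hm Γ hΓ M hM.1 hM.2⟩
  · exact fun M hM => forward _ M hM (models_RCA0.1 hM).2.2
  · refine fun M hM => models_fcp.2 fun φ hφ V v h => ?_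
    cases hφ with
    | base hφ => exact sigma00 M hM hφ V v h fun _ => Iff.rfl
  · rintro M hM _ ⟨φ, hφ, rfl⟩
    rw [sat_imp, sat_finCharFm, sat_maximalFm]
    exact fun h => sigma00 M hM hφ.isBdd _ _ h fun _ => Iff.rfl
  · refine fun m hm => ⟨fun M hM => ?_, fun M hM => ⟨hM.1, ?_⟩⟩
    · exact forward _ M hM.1 (models_ca_mono hM.2.2 Hier0.isArith)
    · have := Fact.mk hM.1
      have hpi := reversal m hm (.pi0 m) (by simp) M hM.1 hM.2
      obtain ⟨l, rfl⟩ := Nat.exists_eq_add_of_le' hm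
      exact models_ca_isArith (models_ca_mono hpi Hier0.pi_one_le)
  · exact fun m hm => ⟨fun M hM => forward _ M hM.1 hM.2.2,
      fun M hM => ⟨hM.1, reversal m hm _ (by simp) M hM.1 hM.2⟩⟩
  · refine fun m hm r => ⟨⟨fun M hM => ?_, fun M hM => ⟨hM.1, ?_⟩⟩,
      ⟨fun M hM => ?_, fun M hM => ⟨hM.1, ?_⟩⟩, ⟨fun M hM => ?_, fun M hM => ⟨hM.1, ?_⟩⟩⟩
    · exact forward _ M hM.1 (toStrict m r M hM.2.2)
    · exact toReading m hm r M hM.1 (reversal m hm (.pi1 .strict m) (by simp) M hM.1 hM.2)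
    · exact forward (.pi1 .closed m) M hM.1 (ofStrict m hm .pi M hM.1 (toStrict m r M hM.2.2))
    · exact toReading m hm r M hM.1
        (toStrict m .closed M (reversal m hm (.pi1 .closed m) (by simp) M hM.1 hM.2))
    · exact forward (.sigma1 .closed m) M hM.1
        (ofStrict m hm .sigma M hM.1 (toStrict m r M hM.2.2))
    · have := Fact.mk hM.1
      exact toReading m hm r M hM.1
        (models_ca_strict_pi_of_sigma (reversal m hm (.sigma1 .closed m) (by simp) M hM.1 hM.2))
  · intro M hM
    have := Fact.mk hM.1
    exact models_fcp_of_ca (fun _ _ _ _ _ => trivial)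
      (models_union.1 (models_union.1 hM.2).1).2
  · intro M hM
    have := Fact.mk hM.1
    have hca := models_ca_of_fcp (fun _ _ _ _ _ => trivial) guardedAll_true hM.2
    refine models_union.2 ⟨models_union.2 ⟨(models_RCA0.1 hM.1).1, hca⟩, ?_⟩
    exact models_ind.2 fun φ _ V v => sat_indFm.2 fun h0 hs =>
      set_induction (models_ca.1 hca φ trivial V v) h0 hs
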